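/- Let $d\ge 1$. An integral $d\times d$ matrix is expansive if all its complex eigenvalues have modulus $>1$. On $L^2(\mathbb R^d)$ (complex-valued functions, Lebesgue measure) put $(T_{v}f)(t)=f(t-v)$ for $v\in\mathbb R^d$, $(U_Mf)(t)=\sqrt{|\det M|}\,f(Mt)$ for an invertible real matrix $M$, and $D_M=U_M$ when $|\det M|=2$. For an integral expansive matrix $B$ with $|\det B|=2$, a function $\psi\in L^2(\mathbb R^d)$ is a Parseval frame wavelet associated with $B$ if $\sum_{n\in\mathbb Z,\ \ell\in\mathbb Z^d}|\langle f,D_B^nT_\ell\psi\rangle|^2=\|f\|^2$ for all $f\in L^2(\mathbb R^d)$. For $f\in L^2(\mathbb R^d)$ let $V_B^{(0)}(f)=\overline{\operatorname{span}}\{T_\ell f:\ell\in\mathbb Z^d\}$ and $V_B^{(n)}(f)=D_B^nV_B^{(0)}(f)$, $n\in\mathbb Z$. The Fourier transform is the unitary extension to $L^2(\mathbb R^d)$ of $(\mathcal Ff)(s)=(2\pi)^{-d/2}\int_{\mathbb R^d}e^{-is\cdot t}f(t)\,dt$. **Theorem.** Let $A_0$ be a $d\times d$ expansive integral matrix with $\det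 A_0=\pm2$. Then there are an integral matrix $A$, an integral matrix $S$ with $\det S=\pm1$ and $A_0=S^{-1}AS$, and vectors $\ell_A,q_A\in\mathbb Z^d$ such that * (P1) $A\mathbb Z^d=A^{\tau}\mathbb Z^d$, where $A^\tau$ is the transpose of $A$; * (P2) $\mathbb Z^d$ is the disjoint union of $\ell_A+A\mathbb Z^d$ and $A\mathbb Z^d$; * (P3) $q_A\cdot x$ is even for $x\in A\mathbb Z^d$ and odd for $x\in \ell_A+A\mathbb Z^d$; * (P4) for all $m\in A\mathbb Z^d$ and $n\in\mathbb Z^d$, $\mathbb Z^d$ is the disjoint union of $n-A\mathbb Z^d$ and $\ell_A-m-n+A\mathbb Z^d$; * (P5) for all $m\in \ell_A+A\mathbb Z^d$ and $n\in\mathbb Z^d$, $n-A\mathbb Z^d=\ell_A-m-n+A\mathbb Z^d$. Moreover, for all such $A,S,\ell_A,q_A$, every $N_0\in\mathbb N$, and every complex family $(h_n)_{n\in\mathbb Z^d}$ that vanishes outside $\Lambda_0=\mathbb Z^d\cap[-N_0,N_0]^d$ and solves Lawton's equations $$\sum_{n\in\mathbb Z^d}h_n\overline{h_{n+k}}=\delta_{0k}\quad(k\in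 A\mathbb Z^d),\qquad \sum_{n\in\mathbb Z^d}h_n=\sqrt2,$$ the following holds. Let $m_0(t)=\frac1{\sqrt2}\sum_{n}h_ne^{-in\cdot t}$. The product $g(\xi)=(2\pi)^{-d/2}\prod_{j=1}^\infty m_0((A^\tau)^{-j}\xi)$ converges (unconditionally) for every $\xi\in\mathbb R^d$, and $g\in L^2(\mathbb R^d)$. Put $$\varphi_A=\mathcal F^{-1}g,\quad \psi_A=\sum_{n\in\mathbb Z^d}(-1)^{q_A\cdot n}\,\overline{h_{\ell_A-n}}\,D_AT_n\varphi_A,\quad \varphi_{A_0}(t)=\varphi_A(St),\quad \psi_{A_0}(t)=\psi_A(St).$$ Then: 1. $\psi_{A_0}$ is a Parseval frame wavelet associated with $A_0$. 2. $\displaystyle\varphi_{A_0}=\sum_{n\in\Lambda_0}h_n\,D_{A_0}T_{S^{-1}n}\varphi_{A_0}$ and $\displaystyle\psi_{A_0}=\sum_{n:\ \ell_A-n\in\Lambda_0}(-1)^{q_A\cdot n}\,\overline{h_{\ell_A-n}}\,D_{A_0}T_{S^{-1}n}\varphi_{A_0}$. 3. $V^{(n)}_{A_0}(\varphi_{A_0})\subset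 V^{(n+1)}_{A_0}(\varphi_{A_0})$ for all $n\in\mathbb Z$. 4. $\overline{\bigcup_{n\in\mathbb Z}V^{(n)}_{A_0}(\varphi_{A_0})}=L^2(\mathbb R^d)$. -/

import Mathlib

open MeasureTheory

namespace ParsevalWavelet

noncomputable section

/-- The Euclidean space `ℝ^d`. -/
abbrev Euc (d : ℕ) : Type := EuclideanSpace ℝ (Fin d)

/-- The Hilbert space `L²(ℝ^d)` of complex-valued functions, for Lebesgue measure. -/
abbrev L2 (d : ℕ) : Type := Lp ℂ 2 (volume : Measure (Euc d))

variable {d : ℕ}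

/-- A real matrix acting on `ℝ^d`. -/
def act (M : Matrix (Fin d) (Fin d) ℝ) (t : Euc d) : Euc d :=
  WithLp.toLp 2 (M.mulVec t.ofLp)

/-- An integral vector, seen in `ℝ^d`. -/
def intVec (n : Fin d → ℤ) : Euc d := WithLp.toLp 2 (fun i => (n i : ℝ))

/-- An integral matrix, seen as a real matrix. -/
def toReal (A : Matrix (Fin d) (Fin d) ℤ) : Matrix (Fin d) (Fin d) ℝ :=
  A.map (fun a : ℤ => (a : ℝ))

/-! ### Translation and dilation operators -/

/-- The translation operator `(T_v f)(t) = f (t - v)` on `L²(ℝ^d)`. -/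
def translation (v : Euc d) : L2 d →ₗᵢ[ℂ] L2 d :=
  Lp.compMeasurePreservingₗᵢ ℂ (fun t : Euc d => t - v) (measurePreserving_sub_right volume v)

theorem coeFn_translation (v : Euc d) (f : L2 d) :
    (translation v f : Euc d → ℂ) =ᵐ[volume] fun t => f (t - v) :=
  Lp.coeFn_compMeasurePreserving f (measurePreserving_sub_right volume v)

theorem act_eq_toEuclideanLin (M : Matrix (Fin d) (Fin d) ℝ) :
    act M = Matrix.toEuclideanLin M := rfl

theorem det_toEuclideanLin (M : Matrix (Fin d) (Fin d) ℝ) :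
    LinearMap.det (Matrix.toEuclideanLin M) = M.det := by
  have h : Matrix.toEuclideanLin M
      = Matrix.toLin (EuclideanSpace.basisFun (Fin d) ℝ).toBasis
          (EuclideanSpace.basisFun (Fin d) ℝ).toBasis M := by
    rw [Matrix.toEuclideanLin_eq_toLin_orthonormal]
  rw [h, LinearMap.det_toLin]

theorem measurable_act (M : Matrix (Fin d) (Fin d) ℝ) : Measurable (act M) := by
  rw [act_eq_toEuclideanLin]
  exact (LinearMap.continuous_of_finiteDimensional _).measurable

theorem act_mul (M N : Matrix (Fin d) (Fin d) ℝ) (t : Euc d) :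
    act M (act N t) = act (M * N) t := by
  simp [act, Matrix.mulVec_mulVec]

theorem act_one (t : Euc d) : act 1 t = t := by
  simp [act]

theorem map_act_volume {M : Matrix (Fin d) (Fin d) ℝ} (hM : M.det ≠ 0) :
    Measure.map (act M) volume = ENNReal.ofReal |M.det⁻¹| • (volume : Measure (Euc d)) := by
  rw [act_eq_toEuclideanLin]
  have h : LinearMap.det (Matrix.toEuclideanLin M) ≠ 0 := by rwa [det_toEuclideanLin]
  rw [Measure.map_linearMap_addHaar_eq_smul_addHaar volume h, det_toEuclideanLin]

theorem quasiMeasurePreserving_act {M : Matrix (Fin d) (Fin d) ℝ} (hM : M.det ≠ 0) :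
    Measure.QuasiMeasurePreserving (act M) (volume : Measure (Euc d)) volume := by
  refine ⟨measurable_act M, ?_⟩
  rw [map_act_volume hM]
  exact Measure.smul_absolutelyContinuous

/-- The function `t ↦ √|det M| f (M t)`. -/
def dilateFun (M : Matrix (Fin d) (Fin d) ℝ) (f : Euc d → ℂ) : Euc d → ℂ :=
  fun t => (Real.sqrt |M.det| : ℂ) * f (act M t)

theorem dilateFun_congr {M : Matrix (Fin d) (Fin d) ℝ} (hM : M.det ≠ 0) {f g : Euc d → ℂ}
    (h : f =ᵐ[volume] g) : dilateFun M f =ᵐ[volume] dilateFun M g := by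
  filter_upwards [(quasiMeasurePreserving_act hM).ae_eq_comp h] with t ht
  simp only [Function.comp_apply] at ht
  simp only [dilateFun, ht]

theorem dilateFun_dilateFun (M N : Matrix (Fin d) (Fin d) ℝ) (f : Euc d → ℂ) :
    dilateFun M (dilateFun N f) = dilateFun (N * M) f := by
  ext t
  simp only [dilateFun, act_mul, Matrix.det_mul, abs_mul, Real.sqrt_mul (abs_nonneg _)]
  push_cast
  ring

theorem dilateFun_one (f : Euc d → ℂ) : dilateFun 1 f = f := by
  ext t
  simp [dilateFun, act_one]

theorem aestronglyMeasurable_dilateFun {M : Matrix (Fin d) (Fin d) ℝ} (hM : M.det ≠ 0)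
    {f : Euc d → ℂ} (hf : AEStronglyMeasurable f volume) :
    AEStronglyMeasurable (dilateFun M f) volume :=
  (hf.comp_quasiMeasurePreserving (quasiMeasurePreserving_act hM)).const_mul _

theorem eLpNorm_dilateFun {M : Matrix (Fin d) (Fin d) ℝ} (hM : M.det ≠ 0) {f : Euc d → ℂ}
    (hf : AEStronglyMeasurable f volume) :
    eLpNorm (dilateFun M f) 2 volume = eLpNorm f 2 volume := by
  have h0 : 0 < |M.det| := abs_pos.mpr hM
  have h1 : dilateFun M f = (Real.sqrt |M.det| : ℂ) • (f ∘ act M) := by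
    ext t; simp [dilateFun]
  have hf' : AEStronglyMeasurable f (Measure.map (act M) volume) := by
    rw [map_act_volume hM]; exact hf.smul_measure _
  rw [h1, eLpNorm_const_smul, ← eLpNorm_map_measure hf' (measurable_act M).aemeasurable,
    map_act_volume hM, eLpNorm_smul_measure_of_ne_top (by norm_num), smul_eq_mul, ← mul_assoc]
  have h2 : ‖(Real.sqrt |M.det| : ℂ)‖ₑ = ENNReal.ofReal (Real.sqrt |M.det|) := by
    rw [← ofReal_norm, Complex.norm_real, Real.norm_of_nonneg (Real.sqrt_nonneg _)]
  have h3 : ENNReal.ofReal |M.det⁻¹| ^ (1 / (2 : ENNReal)).toReal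
      = ENNReal.ofReal (Real.sqrt |M.det|)⁻¹ := by
    rw [ENNReal.ofReal_rpow_of_nonneg (abs_nonneg _) (by positivity), abs_inv]
    congr 1
    rw [← Real.sqrt_inv, Real.sqrt_eq_rpow]
    norm_num
  rw [h2, h3, ← ENNReal.ofReal_mul (Real.sqrt_nonneg _),
    mul_inv_cancel₀ (Real.sqrt_ne_zero'.mpr h0), ENNReal.ofReal_one, one_mul]

theorem memLp_dilateFun {M : Matrix (Fin d) (Fin d) ℝ} (hM : M.det ≠ 0) {f : Euc d → ℂ}
    (hf : MemLp f 2 volume) : MemLp (dilateFun M f) 2 volume :=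
  ⟨aestronglyMeasurable_dilateFun hM hf.1, by rw [eLpNorm_dilateFun hM hf.1]; exact hf.2⟩

/-- The linear isometry `f ↦ √|det M| f (M ·)` of `L²(ℝ^d)`, for an invertible matrix `M`. -/
def dilationIso (M : Matrix (Fin d) (Fin d) ℝ) (hM : M.det ≠ 0) : L2 d →ₗᵢ[ℂ] L2 d where
  toFun f := (memLp_dilateFun hM (Lp.memLp f)).toLp (dilateFun M f)
  map_add' f g := by
    apply Lp.ext
    filter_upwards [(memLp_dilateFun hM (Lp.memLp (f + g))).coeFn_toLp,
      Lp.coeFn_add ((memLp_dilateFun hM (Lp.memLp f)).toLp (dilateFun M f))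
        ((memLp_dilateFun hM (Lp.memLp g)).toLp (dilateFun M g)),
      (memLp_dilateFun hM (Lp.memLp f)).coeFn_toLp,
      (memLp_dilateFun hM (Lp.memLp g)).coeFn_toLp,
      dilateFun_congr hM (Lp.coeFn_add f g)] with t h1 h2 h3 h4 h5
    rw [h1, h2, Pi.add_apply, h3, h4, h5]
    simp [dilateFun, mul_add]
  map_smul' c f := by
    apply Lp.ext
    filter_upwards [(memLp_dilateFun hM (Lp.memLp (c • f))).coeFn_toLp,
      Lp.coeFn_smul c ((memLp_dilateFun hM (Lp.memLp f)).toLp (dilateFun M f)),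
      (memLp_dilateFun hM (Lp.memLp f)).coeFn_toLp,
      dilateFun_congr hM (Lp.coeFn_smul c f)] with t h1 h2 h3 h4
    rw [h1, RingHom.id_apply, h2, Pi.smul_apply, h3, h4]
    simp only [dilateFun, Pi.smul_apply, smul_eq_mul]
    ring
  norm_map' f := by
    change ‖(memLp_dilateFun hM (Lp.memLp f)).toLp (dilateFun M f)‖ = ‖f‖
    rw [Lp.norm_toLp, eLpNorm_dilateFun hM (Lp.memLp f).1, Lp.norm_def]

theorem coeFn_dilationIso {M : Matrix (Fin d) (Fin d) ℝ} (hM : M.det ≠ 0) (f : L2 d) :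
    (dilationIso M hM f : Euc d → ℂ) =ᵐ[volume] dilateFun M f :=
  (memLp_dilateFun hM (Lp.memLp f)).coeFn_toLp

theorem dilationIso_surjective {M : Matrix (Fin d) (Fin d) ℝ} (hM : M.det ≠ 0) :
    Function.Surjective (dilationIso M hM) := by
  intro f
  have hu : IsUnit M.det := isUnit_iff_ne_zero.mpr hM
  have hM' : (M⁻¹).det ≠ 0 := by
    rw [Matrix.det_nonsing_inv]; exact (hu.ringInverse).ne_zero
  refine ⟨dilationIso M⁻¹ hM' f, ?_⟩
  apply Lp.ext
  refine (coeFn_dilationIso hM _).trans ?_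
  refine (dilateFun_congr hM (coeFn_dilationIso hM' f)).trans ?_
  rw [dilateFun_dilateFun, Matrix.nonsing_inv_mul _ hu, dilateFun_one]

open Classical in
/-- The unitary operator `(U_M f)(t) = √|det M| f (M t)` on `L²(ℝ^d)`, for a real matrix `M` with
`det M ≠ 0` (for a singular matrix, which never occurs below, it is the identity by convention).
For `|det M| = 2` it is the dilation operator `D_M`. -/
def dilation (M : Matrix (Fin d) (Fin d) ℝ) : L2 d ≃ₗᵢ[ℂ] L2 d :=
  if hM : M.det ≠ 0 then
    LinearIsometryEquiv.ofSurjective (dilationIso M hM) (dilationIso_surjective hM)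
  else LinearIsometryEquiv.refl ℂ (L2 d)

theorem coeFn_dilation {M : Matrix (Fin d) (Fin d) ℝ} (hM : M.det ≠ 0) (f : L2 d) :
    (dilation M f : Euc d → ℂ) =ᵐ[volume]
      fun t => (Real.sqrt |M.det| : ℂ) * f (act M t) := by
  rw [dilation, dif_pos hM]
  exact coeFn_dilationIso hM f

/-! ### The Fourier transform -/

/-- The unitary Fourier transform on `L²(ℝ^d)` in the normalization
`(ℱ f)(s) = (2π)^(-d/2) ∫ exp(-i s·t) f(t) dt`. It is obtained from Mathlib's Fourier–Plancherel
transform `f ↦ ∫ exp(-2πi s·t) f(t) dt` by the unitary rescaling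
`F ↦ (2π)^(-d/2) F(s / 2π)`, which is `U_M` for `M = (2π)⁻¹ I`. -/
def fourierL2 (d : ℕ) : L2 d ≃ₗᵢ[ℂ] L2 d :=
  (Lp.fourierTransformₗᵢ (Euc d) ℂ).trans
    (dilation ((2 * Real.pi)⁻¹ • (1 : Matrix (Fin d) (Fin d) ℝ)))

theorem fourierL2_toLp (f : SchwartzMap (Euc d) ℂ) :
    fourierL2 d (f.toLp 2) = dilation ((2 * Real.pi)⁻¹ • (1 : Matrix (Fin d) (Fin d) ℝ))
      ((FourierTransform.fourier f : SchwartzMap (Euc d) ℂ).toLp 2) := by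
  rw [← SchwartzMap.toLp_fourier_eq]
  rfl

theorem fourier_act_smul_one (f : Euc d → ℂ) (s : Euc d) :
    FourierTransform.fourier f (act ((2 * Real.pi)⁻¹ • (1 : Matrix (Fin d) (Fin d) ℝ)) s)
      = ∫ t : Euc d, Complex.exp (-Complex.I * (∑ i, s i * t i : ℝ)) * f t := by
  rw [Real.fourier_eq']
  congr 1
  ext t
  have h : (inner ℝ t (act ((2 * Real.pi)⁻¹ • (1 : Matrix (Fin d) (Fin d) ℝ)) s) : ℝ)
      = (2 * Real.pi)⁻¹ * ∑ i, s i * t i := by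
    simp only [act, PiLp.inner_apply, Finset.mul_sum, Matrix.smul_mulVec, Matrix.one_mulVec,
      Pi.smul_apply, smul_eq_mul, RCLike.inner_apply, conj_trivial, mul_assoc]
  have hp : (-2 * Real.pi * ((2 * Real.pi)⁻¹ * ∑ i, s i * t i) : ℝ) = -∑ i, s i * t i := by
    have := Real.pi_ne_zero
    field_simp
  rw [h, smul_eq_mul, hp, Complex.ofReal_neg, neg_mul, neg_mul, mul_comm Complex.I]

/-- On Schwartz functions (a dense subspace of `L²`) the transform is given by the integral. -/
theorem coeFn_fourierL2_schwartz (f : SchwartzMap (Euc d) ℂ) :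
    (fourierL2 d (f.toLp 2) : Euc d → ℂ) =ᵐ[volume] fun s =>
      ((2 * Real.pi) ^ (-(d : ℝ) / 2) : ℝ) *
        ∫ t : Euc d, Complex.exp (-Complex.I * (∑ i, s i * t i : ℝ)) * f t := by
  have hpi : (0 : ℝ) < 2 * Real.pi := by positivity
  have hdet : ((2 * Real.pi)⁻¹ • (1 : Matrix (Fin d) (Fin d) ℝ)).det
      = ((2 * Real.pi)⁻¹) ^ d := by
    rw [Matrix.det_smul, Matrix.det_one, mul_one, Fintype.card_fin]
  have hne : ((2 * Real.pi)⁻¹ • (1 : Matrix (Fin d) (Fin d) ℝ)).det ≠ 0 := by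
    rw [hdet]; positivity
  have hc : Real.sqrt |((2 * Real.pi)⁻¹) ^ d| = (2 * Real.pi) ^ (-(d : ℝ) / 2) := by
    rw [abs_of_nonneg (by positivity), Real.sqrt_eq_rpow, ← Real.rpow_natCast,
      Real.inv_rpow hpi.le, ← Real.rpow_neg hpi.le, ← Real.rpow_mul hpi.le]
    ring_nf
  rw [fourierL2_toLp]
  filter_upwards [coeFn_dilation hne
      ((FourierTransform.fourier f : SchwartzMap (Euc d) ℂ).toLp 2),
    dilateFun_congr hne (SchwartzMap.coeFn_toLp
      (FourierTransform.fourier f : SchwartzMap (Euc d) ℂ) 2)] with s h1 h2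
  simp only [dilateFun] at h2
  rw [h1, h2, hdet, hc, SchwartzMap.fourier_coe, fourier_act_smul_one]

/-! ### Expansive matrices, frames and wavelets -/

/-- An integral matrix is expansive if all its (complex) eigenvalues have modulus `> 1`. -/
def IsExpansive (A : Matrix (Fin d) (Fin d) ℤ) : Prop :=
  ∀ β : ℂ, Module.End.HasEigenvalue (Matrix.toLin' (A.map (fun a : ℤ => (a : ℂ)))) β → 1 < ‖β‖

/-- `(e_i)` is a normalized tight frame (Parseval frame) of `L²(ℝ^d)`:
`∑ |⟨f, e_i⟩|² = ‖f‖²` for all `f`. -/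
def IsNormalizedTightFrame {ι : Type*} (e : ι → L2 d) : Prop :=
  ∀ f : L2 d, HasSum (fun i => ‖(inner ℂ f (e i) : ℂ)‖ ^ 2) (‖f‖ ^ 2)

/-- `ψ` is a Parseval frame wavelet associated with `A`: the family `D_A^n T_ℓ ψ`,
`n ∈ ℤ`, `ℓ ∈ ℤ^d`, is a normalized tight frame of `L²(ℝ^d)`. -/
def IsParsevalFrameWavelet (A : Matrix (Fin d) (Fin d) ℤ) (ψ : L2 d) : Prop :=
  IsNormalizedTightFrame fun p : ℤ × (Fin d → ℤ) =>
    (dilation (toReal A) ^ p.1) (translation (intVec p.2) ψ)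

/-- `V_B^{(0)}(f)`, the closed linear span of the integer translates of `f`. -/
def spaceZero (f : L2 d) : Submodule ℂ (L2 d) :=
  (Submodule.span ℂ (Set.range fun l : Fin d → ℤ => translation (intVec l) f)).topologicalClosure

/-- `V_B^{(n)}(f) = D_B^n V_B^{(0)}(f)`. -/
def space (B : Matrix (Fin d) (Fin d) ℤ) (f : L2 d) (n : ℤ) : Submodule ℂ (L2 d) :=
  (spaceZero f).map (dilation (toReal B) ^ n).toLinearEquiv.toLinearMap

/-! ### The partition properties and Lawton's equations -/

/-- The sublattice `A ℤ^d` of `ℤ^d`. -/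
def lattice (A : Matrix (Fin d) (Fin d) ℤ) : Set (Fin d → ℤ) :=
  Set.range fun n : Fin d → ℤ => A.mulVec n

/-- `A₀ = S⁻¹ A S` with `S` integral of determinant `±1`, and the matrix `A` has, with the vectors
`l = ℓ_A` and `q = q_A`, the five properties of the partition theorem. -/
structure PartitionData (A₀ A S : Matrix (Fin d) (Fin d) ℤ) (l q : Fin d → ℤ) : Prop where
  det_S : |S.det| = 1
  similar : A₀ = S⁻¹ * A * S
  lattice_transpose : lattice A = lattice A.transpose
  union_eq : (fun x => l + x) '' lattice A ∪ lattice A = Set.univ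
  disjoint : Disjoint ((fun x => l + x) '' lattice A) (lattice A)
  even : ∀ x ∈ lattice A, Even (dotProduct q x)
  odd : ∀ x ∈ lattice A, Odd (dotProduct q (l + x))
  union_eq' : ∀ m ∈ lattice A, ∀ n : Fin d → ℤ,
    (fun x => n - x) '' lattice A ∪ (fun x => l - m - n + x) '' lattice A = Set.univ
  disjoint' : ∀ m ∈ lattice A, ∀ n : Fin d → ℤ,
    Disjoint ((fun x => n - x) '' lattice A) ((fun x => l - m - n + x) '' lattice A)
  coset_eq : ∀ m ∈ (fun x => l + x) '' lattice A, ∀ n : Fin d → ℤ,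
    (fun x => n - x) '' lattice A = (fun x => l - m - n + x) '' lattice A

/-- The finite index set `Λ₀ = ℤ^d ∩ [-N₀, N₀]^d`. -/
def box (d N₀ : ℕ) : Finset (Fin d → ℤ) :=
  Finset.Icc (fun _ => -(N₀ : ℤ)) (fun _ => (N₀ : ℤ))

/-- `h` is a finite solution, supported in `Λ₀ = ℤ^d ∩ [-N₀, N₀]^d`, of Lawton's system of
equations associated with `A`. (The sums over `ℤ^d` have only finitely many nonzero terms.) -/
structure IsFiniteLawtonSolution (A : Matrix (Fin d) (Fin d) ℤ) (N₀ : ℕ)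
    (h : (Fin d → ℤ) → ℂ) : Prop where
  finite : ∀ n, n ∉ box d N₀ → h n = 0
  orthogonality : ∀ k ∈ lattice A,
    ∑ᶠ n : Fin d → ℤ, h n * (starRingEnd ℂ) (h (n + k)) = if k = 0 then 1 else 0
  normalization : ∑ᶠ n : Fin d → ℤ, h n = (Real.sqrt 2 : ℂ)

/-! ### Filter, scaling function and wavelet -/

/-- The filter `m₀(t) = (1/√2) ∑_n h_n exp(-i n·t)`. -/
def filterFun (h : (Fin d → ℤ) → ℂ) (t : Euc d) : ℂ :=
  (1 / Real.sqrt 2 : ℝ) *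
    ∑ᶠ n : Fin d → ℤ, h n * Complex.exp (-Complex.I * (∑ i, (n i : ℝ) * t i : ℝ))

/-- The factors `m₀((Aᵀ)^(-j) ξ)`, `j = 1, 2, …`, indexed by `j - 1`. -/
def factor (A : Matrix (Fin d) (Fin d) ℤ) (h : (Fin d → ℤ) → ℂ) (ξ : Euc d) (j : ℕ) : ℂ :=
  filterFun h (act ((toReal A).transpose⁻¹ ^ (j + 1)) ξ)

/-- `g(ξ) = (2π)^(-d/2) ∏_{j ≥ 1} m₀((Aᵀ)^(-j) ξ)`. -/
def scalingFourier (A : Matrix (Fin d) (Fin d) ℤ) (h : (Fin d → ℤ) → ℂ) (ξ : Euc d) : ℂ :=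
  ((2 * Real.pi) ^ (-(d : ℝ) / 2) : ℝ) * ∏' j : ℕ, factor A h ξ j

/-- The scaling function `φ_A = ℱ⁻¹ g`, once `g` is known to be square integrable. -/
def scaling (A : Matrix (Fin d) (Fin d) ℤ) (h : (Fin d → ℤ) → ℂ)
    (hg : MemLp (scalingFourier A h) 2 (volume : Measure (Euc d))) : L2 d :=
  (fourierL2 d).symm (hg.toLp (scalingFourier A h))

/-- `ψ_A = ∑_n (-1)^(q·n) conj(h_{ℓ-n}) D_A T_n φ`, for `l = ℓ_A`, `q = q_A`, `φ = φ_A`. -/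
def wavelet (A : Matrix (Fin d) (Fin d) ℤ) (l q : Fin d → ℤ) (h : (Fin d → ℤ) → ℂ)
    (φ : L2 d) : L2 d :=
  ∑ᶠ n : Fin d → ℤ, ((-1 : ℂ) ^ (dotProduct q n) * (starRingEnd ℂ) (h (l - n))) •
    dilation (toReal A) (translation (intVec n) φ)

/-- `φ_{A₀} = U_S φ_A`, that is `φ_{A₀}(t) = φ_A(S t)`, as `|det S| = 1`. -/
def scalingPullback (A S : Matrix (Fin d) (Fin d) ℤ) (h : (Fin d → ℤ) → ℂ)
    (hg : MemLp (scalingFourier A h) 2 (volume : Measure (Euc d))) : L2 d :=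
  dilation (toReal S) (scaling A h hg)

/-- `ψ_{A₀} = U_S ψ_A`, that is `ψ_{A₀}(t) = ψ_A(S t)`, as `|det S| = 1`. -/
def waveletPullback (A S : Matrix (Fin d) (Fin d) ℤ) (l q : Fin d → ℤ) (h : (Fin d → ℤ) → ℂ)
    (hg : MemLp (scalingFourier A h) 2 (volume : Measure (Euc d))) : L2 d :=
  dilation (toReal S) (wavelet A l q h (scaling A h hg))

end

end ParsevalWavelet

open MeasureTheory

namespace ParsevalWavelet

noncomputable section

variable {d : ℕ}

/-! ### The partition theorem -/

/-! Partition. As `|det A₀| = 2`, the lattice `A₀ ℤ^d` has index two, so it is the kernel of `x ↦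
q·x mod 2`; likewise the transposed lattice, with some `p` (`exists_parity`). Conjugation by `S`
turns these functionals into `q S⁻¹` and `S p`, so (P1) asks that they agree mod 2. A transvection
over `𝔽₂` achieves this (`exists_transvection_vectors`), and it lifts to `SL_d(ℤ)`
(`exists_lift_zmodTwo`). The other properties are then statements about parities.

Scaling function. Expansiveness makes the powers of `(Aᵀ)⁻¹` contract geometrically, and `∑ h_n =
√2` says that the mask is `1` at the origin; hence the infinite product `G` converges and is close
to `1` near `0`. Square integrability comes from the cascade `x ↦ ∑ h_n D_A T_n x`. By Lawton's
equations it preserves orthonormality of the integer translates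
(`IsFiniteLawtonSolution.orthonormal_refine`). It is started at the function whose Fourier transform
is the indicator of the unit cube, and on the Fourier side the iterates converge pointwise to `G`.
Orthonormality may be lost in the limit, but Fatou's lemma keeps the inequality `‖∑ c_k T_k φ‖ ≤
‖c‖` (`IsFiniteLawtonSolution.eLpNorm_trig_mul_maskProd_le`), that is, a Bessel bound `1`
(`IsFiniteLawtonSolution.isScaling`).

Frame. Let `T f = (⟨T_k φ, f⟩)_k`. Lawton's equations also make the rows of the polyphase matrix of
the low-pass and high-pass filters orthonormal (`IsFiniteLawtonSolution.hasSum_polyphase`), whence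
`∑_m |⟨T_m ψ, f⟩|² = ‖T D⁻¹ f‖² - ‖T f‖²` (`IsFiniteLawtonSolution.hasSum_wavelet_level`). Summed
over all scales this telescopes to `‖f‖²`. Indeed `‖T D⁻ⁿ f‖ → ‖f‖`, because the spectrum
concentrates where `G` is near `1`, and `‖T Dⁿ f‖ → 0`, because the support shrinks to a point.

The refinement equation gives the nesting of the spaces. The frame identity gives density: a vector
orthogonal to every `V^(n)` is orthogonal to the whole frame. The unitary `U_S` carries everything
from `A` to `A₀`. -/

theorem mem_lattice {A : Matrix (Fin d) (Fin d) ℤ} {x : Fin d → ℤ} :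
    x ∈ lattice A ↔ ∃ n, A.mulVec n = x := Iff.rfl

theorem even_dotProduct_iff (q x : Fin d → ℤ) :
    Even (dotProduct q x) ↔
      dotProduct (fun i => (q i : ZMod 2)) (fun i => (x i : ZMod 2)) = 0 := by
  rw [even_iff_two_dvd, ← Nat.cast_two, ← ZMod.intCast_zmod_eq_zero_iff_dvd]
  simp [dotProduct]

/-- A sublattice `A ℤ^d` of index two is the kernel of a parity functional. -/
theorem exists_parity {A : Matrix (Fin d) (Fin d) ℤ} (hA : A.det.natAbs = 2) :
    ∃ q : Fin d → ℤ, (∀ x, x ∈ lattice A ↔ Even (dotProduct q x)) ∧ ∃ l, Odd (dotProduct q l) := by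
  classical
  have hinj : Function.Injective (Matrix.toLin' A) := by
    rw [← LinearMap.ker_eq_bot, LinearMap.ker_eq_bot']
    intro m hm
    rw [Matrix.toLin'_apply] at hm
    by_contra hne
    have := Matrix.exists_mulVec_eq_zero_iff.mp ⟨m, hne, hm⟩
    simp [this] at hA
  let N := LinearMap.range (Matrix.toLin' A)
  let e : (Fin d → ℤ) ≃ₗ[ℤ] N := LinearEquiv.ofInjective _ hinj
  -- The index of the image of an injective endomorphism of `ℤ^d` is the absolute value of its
  -- determinant.
  have hcard := Submodule.natAbs_det_equiv N e
  have hcomp : N.subtype ∘ₗ AddMonoidHom.toIntLinearMap (e : (Fin d → ℤ) →+ N)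
      = Matrix.toLin' A := by
    ext; rfl
  rw [hcomp, LinearMap.det_toLin', hA] at hcard
  have hidx : N.toAddSubgroup.index = 2 := hcard.symm
  have hmem : ∀ x, x ∈ lattice A ↔ x ∈ N.toAddSubgroup := fun x => Iff.rfl
  set H := N.toAddSubgroup
  -- In a subgroup of index two, membership of a sum depends only on how many summands lie outside,
  -- so it suffices to record which basis vectors do.
  let q : Fin d → ℤ := fun i => if Pi.single i (1 : ℤ) ∈ H then 0 else 1
  have key : ∀ x : Fin d → ℤ, x ∈ H ↔ Even (dotProduct q x) := by
    intro x
    have hs : ∀ s : Finset (Fin d), (∑ i ∈ s, x i • (Pi.single i (1 : ℤ) : Fin d → ℤ)) ∈ H ↔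
        Even (∑ i ∈ s, q i * x i) := by
      intro s
      induction s using Finset.induction_on with
      | empty => simp [H.zero_mem]
      | insert i s hi ih =>
        rw [Finset.sum_insert hi, Finset.sum_insert hi, AddSubgroup.add_mem_iff_of_index_two hidx,
          ih, Int.even_add]
        refine iff_congr ?_ Iff.rfl
        by_cases h : (Pi.single i (1 : ℤ) : Fin d → ℤ) ∈ H
        · simp only [q, h, if_true, zero_mul, Even.zero, iff_true]
          exact H.zsmul_mem h _
        · simp only [q, h, if_false, one_mul]
          -- Doubles lie in every subgroup of index two, so only the parity of the coefficient
          -- matters.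
          have h2 : ∀ k : ℤ, (k + k) • (Pi.single i (1 : ℤ) : Fin d → ℤ) ∈ H := by
            intro k
            rw [add_smul]
            exact AddSubgroup.add_self_mem_of_index_two hidx _
          rcases Int.even_or_odd (x i) with ⟨k, hk⟩ | ⟨k, hk⟩
          · exact iff_of_true (hk ▸ h2 k) ⟨k, hk⟩
          · refine iff_of_false ?_ (Int.not_even_iff_odd.mpr ⟨k, hk⟩)
            rw [hk, two_mul, add_smul, one_smul, AddSubgroup.add_mem_iff_of_index_two hidx]
            exact fun hh => h (hh.mp (h2 k))
    have hx : ∑ i, x i • (Pi.single i (1 : ℤ) : Fin d → ℤ) = x := by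
      ext j
      simp [Finset.sum_apply, Pi.single_apply]
    rw [← hx, hs, hx]
    rfl
  refine ⟨q, fun x => (hmem x).trans (key x), ?_⟩
  obtain ⟨a, ha⟩ := AddSubgroup.index_eq_two_iff.mp hidx
  have h0 := ha 0
  rw [zero_add] at h0
  refine ⟨a, Int.not_even_iff_odd.mp ?_⟩
  rw [← key]
  rcases h0 with h | h
  · exact absurd H.zero_mem h.2
  · exact h.2

/-! ### Transvections over the field with two elements -/

theorem zmodTwo_eq_zero_or_one (z : ZMod 2) : z = 0 ∨ z = 1 := by
  revert z; decide

theorem add_self_vec (v : Fin d → ZMod 2) : v + v = 0 := by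
  ext i
  exact CharTwo.add_self_eq_zero _

/-- Two nonzero vectors over `𝔽₂` are moved to the same vector by a transvection and its
contragredient. -/
theorem exists_transvection_vectors {p q : Fin d → ZMod 2} (hp : p ≠ 0) (hq : q ≠ 0) :
    ∃ u w : Fin d → ZMod 2, dotProduct u w = 0 ∧
      p + dotProduct u p • w = q + dotProduct q w • u := by
  classical
  -- A coordinate vector works if the supports of `p` and `q` meet; otherwise add one coordinate
  -- vector from each support.
  have hu : ∃ u : Fin d → ZMod 2, dotProduct u p = 1 ∧ dotProduct u q = 1 := by
    by_cases h : ∃ i, p i = 1 ∧ q i = 1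
    · obtain ⟨i, h1, h2⟩ := h
      exact ⟨Pi.single i 1, by simp [h1], by simp [h2]⟩
    · push Not at h
      obtain ⟨i, hi⟩ := Function.ne_iff.mp hp
      obtain ⟨j, hj⟩ := Function.ne_iff.mp hq
      have hi1 : p i = 1 := (zmodTwo_eq_zero_or_one _).resolve_left hi
      have hj1 : q j = 1 := (zmodTwo_eq_zero_or_one _).resolve_left hj
      have hi0 : q i = 0 := (zmodTwo_eq_zero_or_one _).resolve_right (h i hi1)
      have hj0 : p j = 0 := (zmodTwo_eq_zero_or_one _).resolve_right fun h' => h j h' hj1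
      exact ⟨Pi.single i 1 + Pi.single j 1, by simp [add_dotProduct, hi1, hj0],
        by simp [add_dotProduct, hi0, hj1]⟩
  obtain ⟨u, hup, huq⟩ := hu
  have h11 : (1 : ZMod 2) + 1 = 0 := by decide
  by_cases h1 : dotProduct p q = dotProduct q q
  -- Here `q·w = 0` for `w = p + q`, and both sides equal `q`. In the next case the roles of `u` and
  -- `w` are exchanged and both sides equal `p`.
  · refine ⟨u, p + q, by rw [dotProduct_add, hup, huq, h11], ?_⟩
    rw [hup, dotProduct_add, dotProduct_comm q p, h1, CharTwo.add_self_eq_zero, one_smul, zero_smul,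
      ← add_assoc, add_self_vec, zero_add, add_zero]
  by_cases h2 : dotProduct p q = dotProduct p p
  · refine ⟨p + q, u, by rw [dotProduct_comm, dotProduct_add, hup, huq, h11], ?_⟩
    rw [dotProduct_comm q u, huq, add_dotProduct, dotProduct_comm q p, h2,
      CharTwo.add_self_eq_zero, one_smul, zero_smul, add_comm p q, ← add_assoc, add_self_vec,
      zero_add, add_zero]
  -- Since `p·q ≠ q·q`, the support of `q` is not contained in that of `p`; a coordinate `i` where
  -- this fails makes both sides `p + e_i`.
  have hi : ∃ i, p i = 0 ∧ q i = 1 := by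
    by_contra h
    push Not at h
    apply h1
    refine Finset.sum_congr rfl fun i _ => ?_
    rcases zmodTwo_eq_zero_or_one (p i) with hi | hi
    · rw [(zmodTwo_eq_zero_or_one _).resolve_right (h i hi)]; simp
    · rcases zmodTwo_eq_zero_or_one (q i) with hj | hj <;> simp [hi, hj]
  obtain ⟨i, hpi, hqi⟩ := hi
  have h3 : dotProduct p p + dotProduct p q = 1 := by
    rcases zmodTwo_eq_zero_or_one (dotProduct p p) with h | h <;>
    rcases zmodTwo_eq_zero_or_one (dotProduct p q) with h' | h' <;> simp_all
  refine ⟨p + q + Pi.single i 1, Pi.single i 1, by simp [hpi, hqi, h11], ?_⟩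
  have e1 : dotProduct (p + q + Pi.single i 1) p = 1 := by
    rw [add_dotProduct, add_dotProduct, dotProduct_comm q p, h3]; simp [hpi]
  have e2 : dotProduct q (Pi.single i 1) = 1 := by simp [hqi]
  rw [e1, e2, one_smul, one_smul, ← add_assoc, add_comm p q, ← add_assoc, add_self_vec, zero_add]

/-- `SL_d(ℤ) → GL_d(𝔽₂)` is surjective. -/
theorem exists_lift_zmodTwo (M : Matrix (Fin d) (Fin d) (ZMod 2)) (hM : M.det ≠ 0) :
    ∃ S : Matrix (Fin d) (Fin d) ℤ, S.det = 1 ∧ S.map (fun a : ℤ => (a : ZMod 2)) = M := by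
  have : Fact (Nat.Prime 2) := ⟨Nat.prime_two⟩
  refine Matrix.diagonal_transvection_induction_of_det_ne_zero
    (fun M => ∃ S : Matrix (Fin d) (Fin d) ℤ, S.det = 1 ∧
      S.map (fun a : ℤ => (a : ZMod 2)) = M) M hM ?_ ?_ ?_
  · intro D hD
    refine ⟨1, Matrix.det_one, ?_⟩
    -- The only nonzero scalar of `𝔽₂` is `1`, so the diagonal part is trivial to lift.
    have h1 : D = fun _ => 1 := by
      ext i
      refine (zmodTwo_eq_zero_or_one _).resolve_left fun h => hD ?_
      rw [Matrix.det_diagonal]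
      exact Finset.prod_eq_zero (Finset.mem_univ i) h
    rw [h1, Matrix.map_one _ (by simp) (by simp)]
    exact Matrix.diagonal_one.symm
  · intro t
    refine ⟨Matrix.transvection t.i t.j (t.c.val : ℤ), Matrix.det_transvection_of_ne _ _ t.hij _, ?_⟩
    ext i j
    simp [Matrix.transvection, Matrix.TransvectionStruct.toMatrix, Matrix.single_apply,
      Matrix.one_apply]
  · rintro A B - - ⟨S, hS, rfl⟩ ⟨T, hT, rfl⟩
    refine ⟨S * T, by rw [Matrix.det_mul, hS, hT, one_mul], ?_⟩
    exact Matrix.map_mul (f := Int.castRingHom (ZMod 2))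

/-- All the partition properties follow from a description of the lattice by parity. -/
theorem PartitionData.of_parity {A₀ A S : Matrix (Fin d) (Fin d) ℤ} {l q : Fin d → ℤ}
    (hS : |S.det| = 1) (hsim : A₀ = S⁻¹ * A * S) (htr : lattice A = lattice A.transpose)
    (hq : ∀ x, x ∈ lattice A ↔ Even (dotProduct q x)) (hl : Odd (dotProduct q l)) :
    PartitionData A₀ A S l q := by
  have hl' : ¬ Even (dotProduct q l) := Int.not_even_iff_odd.mpr hl
  -- Membership in a coset of the lattice is a comparison of parities; this turns the partition
  -- properties into propositional tautologies.
  have himg : ∀ a x : Fin d → ℤ, x ∈ (fun y => a + y) '' lattice A ↔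
      (Even (dotProduct q x) ↔ Even (dotProduct q a)) := by
    intro a x
    rw [← Int.even_sub, ← dotProduct_sub, ← hq]
    exact ⟨by rintro ⟨y, hy, rfl⟩; simpa using hy, fun h => ⟨_, h, by simp⟩⟩
  have himg' : ∀ a x : Fin d → ℤ, x ∈ (fun y => a - y) '' lattice A ↔
      (Even (dotProduct q x) ↔ Even (dotProduct q a)) := by
    intro a x
    rw [iff_comm (a := Even (dotProduct q x)), ← Int.even_sub, ← dotProduct_sub, ← hq]
    exact ⟨by rintro ⟨y, hy, rfl⟩; simpa using hy, fun h => ⟨_, h, by simp⟩⟩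
  refine ⟨hS, hsim, htr, ?_, ?_, fun x hx => (hq x).mp hx, ?_, ?_, ?_, ?_⟩
  · ext x
    rw [Set.mem_union, himg, hq]
    simp only [hl', iff_false, Set.mem_univ, iff_true]
    tauto
  · rw [Set.disjoint_left]
    intro x hx
    rw [himg] at hx
    rw [hq]
    tauto
  · intro x hx
    rw [dotProduct_add]
    exact hl.add_even ((hq x).mp hx)
  · intro m hm n
    ext x
    rw [hq] at hm
    rw [Set.mem_union, himg, himg', dotProduct_sub, dotProduct_sub, Int.even_sub, Int.even_sub]
    simp only [Set.mem_univ, iff_true]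
    tauto
  · intro m hm n
    rw [hq] at hm
    rw [Set.disjoint_left]
    intro x hx
    rw [himg'] at hx
    rw [himg, dotProduct_sub, dotProduct_sub, Int.even_sub, Int.even_sub]
    tauto
  · intro m hm n
    rw [himg] at hm
    ext x
    rw [himg, himg', dotProduct_sub, dotProduct_sub, Int.even_sub, Int.even_sub]
    tauto

/-- An element outside `A ℤ^d` lies in the other coset, where the functional is odd. -/
theorem PartitionData.parity {A₀ A S : Matrix (Fin d) (Fin d) ℤ} {l q : Fin d → ℤ}
    (hP : PartitionData A₀ A S l q) (x : Fin d → ℤ) :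
    x ∈ lattice A ↔ Even (dotProduct q x) := by
  refine ⟨hP.even x, fun hx => ?_⟩
  have hu : x ∈ (fun y => l + y) '' lattice A ∪ lattice A := hP.union_eq ▸ Set.mem_univ x
  rcases hu with ⟨y, hy, rfl⟩ | h
  · exact absurd hx (Int.not_even_iff_odd.mpr (hP.odd y hy))
  · exact h

theorem PartitionData.odd_shift {A₀ A S : Matrix (Fin d) (Fin d) ℤ} {l q : Fin d → ℤ}
    (hP : PartitionData A₀ A S l q) : Odd (dotProduct q l) := by
  simpa using hP.odd 0 ⟨0, by simp⟩

theorem PartitionData.isUnit_det_S {A₀ A S : Matrix (Fin d) (Fin d) ℤ} {l q : Fin d → ℤ}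
    (hP : PartitionData A₀ A S l q) : IsUnit S.det :=
  Int.isUnit_iff_abs_eq.mpr hP.det_S

/-- With `S ≡ 1 + w uᵀ` mod 2 and `u·w = 0`, the matrix `S` is its own inverse mod 2. The congruence
`S p ≡ q S⁻¹` needed for (P1) then reads `p + (u·p) w = q + (q·w) u`, the equation solved by
`exists_transvection_vectors`. -/
theorem exists_partitionData (A₀ : Matrix (Fin d) (Fin d) ℤ) (hdet : A₀.det.natAbs = 2) :
    ∃ (A S : Matrix (Fin d) (Fin d) ℤ) (l q : Fin d → ℤ), PartitionData A₀ A S l q := by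
  obtain ⟨q, hq, lq, hlq⟩ := exists_parity hdet
  obtain ⟨p, hp, lp, hlp⟩ := exists_parity (A := A₀.transpose) (by rwa [Matrix.det_transpose])
  have hne : ∀ {v l : Fin d → ℤ}, Odd (dotProduct v l) → (fun i => (v i : ZMod 2)) ≠ 0 := by
    intro v l h h0
    rw [← Int.not_even_iff_odd, even_dotProduct_iff, h0] at h
    simp at h
  obtain ⟨u, w, huw, hpq⟩ := exists_transvection_vectors (hne hlp) (hne hlq)
  let M : Matrix (Fin d) (Fin d) (ZMod 2) := 1 + Matrix.vecMulVec w u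
  -- The square of `w uᵀ` vanishes as `u·w = 0`, and the cross terms cancel in characteristic two.
  have hMM : M * M = 1 := by
    simp only [M, mul_add, add_mul, Matrix.vecMulVec_mul_vecMulVec, huw, mul_one, one_mul]
    rw [zero_smul, Matrix.vecMulVec_zero, add_zero, add_assoc,
      show Matrix.vecMulVec w u + Matrix.vecMulVec w u = 0 from ?_, add_zero]
    ext i j
    exact CharTwo.add_self_eq_zero _
  obtain ⟨S, hS, hSM⟩ := exists_lift_zmodTwo M (by
    intro h
    have := congrArg Matrix.det hMM
    simp [h] at this)
  have hSu : IsUnit S.det := by rw [hS]; exact isUnit_one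
  have hSS : S * S⁻¹ = 1 := Matrix.mul_nonsing_inv _ hSu
  have hSS' : S⁻¹ * S = 1 := Matrix.nonsing_inv_mul _ hSu
  have hSM' : (S⁻¹).map (fun a : ℤ => (a : ZMod 2)) = M := by
    have h1 : S.map (fun a : ℤ => (a : ZMod 2)) * (S⁻¹).map (fun a : ℤ => (a : ZMod 2)) = 1 := by
      have := congrArg (fun X : Matrix (Fin d) (Fin d) ℤ => X.map (Int.castRingHom (ZMod 2))) hSS
      simp only [Matrix.map_mul] at this
      rw [Matrix.map_one _ (by simp) (by simp)] at this
      exact this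
    calc _ = M * (M * (S⁻¹).map (fun a : ℤ => (a : ZMod 2))) := by rw [← mul_assoc, hMM, one_mul]
      _ = M := by rw [← hSM, h1, mul_one]
  have hmemA : ∀ x, x ∈ lattice (S * A₀ * S⁻¹) ↔ Even (dotProduct (Matrix.vecMul q S⁻¹) x) := by
    intro x
    rw [← Matrix.dotProduct_mulVec, ← hq, mem_lattice, mem_lattice]
    constructor
    · rintro ⟨n, rfl⟩
      refine ⟨S⁻¹.mulVec n, ?_⟩
      simp only [Matrix.mulVec_mulVec, ← mul_assoc, hSS', one_mul]
    · rintro ⟨n, hn⟩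
      refine ⟨S.mulVec n, ?_⟩
      rw [Matrix.mulVec_mulVec, mul_assoc, hSS', mul_one, ← Matrix.mulVec_mulVec, hn,
        Matrix.mulVec_mulVec, hSS, Matrix.one_mulVec]
  have hmemT : ∀ x, x ∈ lattice (S * A₀ * S⁻¹).transpose ↔ Even (dotProduct (S.mulVec p) x) := by
    intro x
    have hT : S.transpose * (S⁻¹).transpose = 1 := by
      rw [← Matrix.transpose_mul, hSS', Matrix.transpose_one]
    have hT' : (S⁻¹).transpose * S.transpose = 1 := by
      rw [← Matrix.transpose_mul, hSS, Matrix.transpose_one]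
    rw [← Matrix.vecMul_transpose, ← Matrix.dotProduct_mulVec, ← hp, mem_lattice, mem_lattice,
      Matrix.transpose_mul, Matrix.transpose_mul, ← mul_assoc]
    constructor
    · rintro ⟨n, rfl⟩
      refine ⟨S.transpose.mulVec n, ?_⟩
      simp only [Matrix.mulVec_mulVec, ← mul_assoc, hT, one_mul]
    · rintro ⟨n, hn⟩
      refine ⟨(S⁻¹).transpose.mulVec n, ?_⟩
      rw [Matrix.mulVec_mulVec, mul_assoc, hT, mul_one, ← Matrix.mulVec_mulVec, hn,
        Matrix.mulVec_mulVec, hT', Matrix.one_mulVec]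
  have hvec : (fun i => ((S.mulVec p i : ℤ) : ZMod 2))
      = fun i => ((Matrix.vecMul q S⁻¹ i : ℤ) : ZMod 2) := by
    have h1 : (fun i => ((S.mulVec p i : ℤ) : ZMod 2))
        = M.mulVec (fun i => (p i : ZMod 2)) := by
      rw [← hSM]; ext i; simp [Matrix.mulVec, dotProduct]
    have h2 : (fun i => ((Matrix.vecMul q S⁻¹ i : ℤ) : ZMod 2))
        = Matrix.vecMul (fun i => (q i : ZMod 2)) M := by
      rw [← hSM']; ext i; simp [Matrix.vecMul, dotProduct]
    rw [h1, h2]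
    simp only [M, Matrix.add_mulVec, Matrix.vecMul_add, Matrix.one_mulVec, Matrix.vecMul_one,
      Matrix.vecMulVec_mulVec, Matrix.vecMul_vecMulVec]
    simpa using hpq
  refine ⟨S * A₀ * S⁻¹, S, S.mulVec lq, Matrix.vecMul q S⁻¹, .of_parity (by simp [hS]) ?_ ?_ hmemA ?_⟩
  · rw [← mul_assoc, ← mul_assoc, hSS', one_mul, mul_assoc, hSS', mul_one]
  · ext x
    rw [hmemA, hmemT, even_dotProduct_iff, even_dotProduct_iff, hvec]
  · rwa [← Matrix.dotProduct_mulVec, Matrix.mulVec_mulVec, hSS', Matrix.one_mulVec]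

/-! ### Algebra of translations and dilations -/

theorem act_sub (M : Matrix (Fin d) (Fin d) ℝ) (s t : Euc d) : act M (s - t) = act M s - act M t := by
  rw [act_eq_toEuclideanLin, map_sub]

theorem continuous_act (M : Matrix (Fin d) (Fin d) ℝ) : Continuous (act M) := by
  rw [act_eq_toEuclideanLin]
  exact LinearMap.continuous_of_finiteDimensional _

theorem inner_act (M : Matrix (Fin d) (Fin d) ℝ) (s t : Euc d) :
    inner ℝ (act M s) t = inner ℝ s (act M.transpose t) := by
  simp only [act, EuclideanSpace.inner_eq_star_dotProduct, star_trivial]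
  rw [Matrix.dotProduct_mulVec, Matrix.mulVec_transpose]

theorem intVec_add (m n : Fin d → ℤ) : intVec (m + n) = intVec m + intVec n := by
  ext i; simp [intVec]

theorem intVec_zero : intVec (0 : Fin d → ℤ) = 0 := by
  ext i; simp [intVec]

theorem intVec_neg (m : Fin d → ℤ) : intVec (-m) = -intVec m := by
  ext i; simp [intVec]

theorem act_intVec (A : Matrix (Fin d) (Fin d) ℤ) (n : Fin d → ℤ) :
    act (toReal A) (intVec n) = intVec (A.mulVec n) := by
  ext i
  simp [act, intVec, toReal, Matrix.mulVec, dotProduct]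

theorem det_toReal (A : Matrix (Fin d) (Fin d) ℤ) : (toReal A).det = (A.det : ℝ) :=
  (Int.cast_det A).symm

theorem toReal_mul (A B : Matrix (Fin d) (Fin d) ℤ) : toReal (A * B) = toReal A * toReal B :=
  Matrix.map_mul (f := Int.castRingHom ℝ)

theorem det_inv_ne_zero {M : Matrix (Fin d) (Fin d) ℝ} (hM : M.det ≠ 0) : M⁻¹.det ≠ 0 := by
  rw [Matrix.det_nonsing_inv]
  exact (isUnit_iff_ne_zero.mpr hM).ringInverse.ne_zero

theorem det_transpose_inv_ne_zero {M : Matrix (Fin d) (Fin d) ℝ} (hM : M.det ≠ 0) :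
    M.transpose⁻¹.det ≠ 0 :=
  det_inv_ne_zero (by rwa [Matrix.det_transpose])

theorem act_ae_comp {M : Matrix (Fin d) (Fin d) ℝ} (hM : M.det ≠ 0) {p : Euc d → Prop}
    (h : ∀ᵐ t, p t) : ∀ᵐ t, p (act M t) :=
  (quasiMeasurePreserving_act hM).ae h

theorem sub_ae_comp (v : Euc d) {p : Euc d → Prop}
    (h : ∀ᵐ t, p t) : ∀ᵐ t, p (t - v) :=
  (measurePreserving_sub_right volume v).quasiMeasurePreserving.ae h

theorem translation_add (v w : Euc d) (f : L2 d) :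
    translation v (translation w f) = translation (v + w) f := by
  apply Lp.ext
  filter_upwards [coeFn_translation v (translation w f), coeFn_translation (v + w) f,
    sub_ae_comp v (coeFn_translation w f)] with t h1 h2 h3
  rw [h1, h2, h3, sub_sub]

theorem translation_zero (f : L2 d) : translation 0 f = f := by
  apply Lp.ext
  filter_upwards [coeFn_translation 0 f] with t h1
  rw [h1, sub_zero]

theorem dilation_dilation {M N : Matrix (Fin d) (Fin d) ℝ} (hM : M.det ≠ 0) (hN : N.det ≠ 0)
    (f : L2 d) : dilation M (dilation N f) = dilation (N * M) f := by
  have hNM : (N * M).det ≠ 0 := by rw [Matrix.det_mul]; exact mul_ne_zero hN hM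
  apply Lp.ext
  filter_upwards [coeFn_dilation hM (dilation N f), coeFn_dilation hNM f,
    act_ae_comp hM (coeFn_dilation hN f)] with t h1 h2 h3
  rw [h1, h2, h3, act_mul, Matrix.det_mul, abs_mul, Real.sqrt_mul (abs_nonneg _)]
  push_cast
  ring

theorem dilation_one (f : L2 d) : dilation 1 f = f := by
  apply Lp.ext
  filter_upwards [coeFn_dilation (M := 1) (by simp) f] with t h1
  rw [h1]
  simp [act_one]

theorem dilation_pow {M : Matrix (Fin d) (Fin d) ℝ} (hM : M.det ≠ 0) (n : ℕ) (f : L2 d) :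
    (dilation M ^ n) f = dilation (M ^ n) f := by
  induction n with
  | zero => rw [pow_zero, pow_zero, dilation_one]; rfl
  | succ n ih =>
    rw [pow_succ', LinearIsometryEquiv.coe_mul, Function.comp_apply, ih, dilation_dilation hM, pow_succ]
    rw [Matrix.det_pow]
    exact pow_ne_zero _ hM

theorem dilation_inv_apply {M : Matrix (Fin d) (Fin d) ℝ} (hM : M.det ≠ 0) (f : L2 d) :
    (dilation M)⁻¹ f = dilation M⁻¹ f := by
  change (dilation M).symm f = _
  rw [LinearIsometryEquiv.symm_apply_eq, dilation_dilation hM (det_inv_ne_zero hM),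
    Matrix.nonsing_inv_mul _ (isUnit_iff_ne_zero.mpr hM), dilation_one]

theorem dilation_inv {M : Matrix (Fin d) (Fin d) ℝ} (hM : M.det ≠ 0) :
    (dilation M)⁻¹ = dilation M⁻¹ :=
  LinearIsometryEquiv.ext (dilation_inv_apply hM)

theorem translation_dilation {M : Matrix (Fin d) (Fin d) ℝ} (hM : M.det ≠ 0) (v : Euc d) (f : L2 d) :
    translation v (dilation M f) = dilation M (translation (act M v) f) := by
  apply Lp.ext
  filter_upwards [coeFn_translation v (dilation M f), sub_ae_comp v (coeFn_dilation hM f),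
    coeFn_dilation hM (translation (act M v) f),
    act_ae_comp hM (coeFn_translation (act M v) f)] with t h1 h2 h3 h4
  rw [h1, h2, h3, h4, act_sub]

/-! ### The Fourier transform of translates and dilates -/

/-- The Fourier transform in the normalization `∫ exp(-2πi s·t) f(t) dt`. -/
abbrev FT (d : ℕ) : L2 d ≃ₗᵢ[ℂ] L2 d := Lp.fourierTransformₗᵢ (Euc d) ℂ

/-- The character `s ↦ exp(-2πi v·s)`. -/
def wave (v s : Euc d) : ℂ := Complex.exp (((-2 * Real.pi * inner ℝ v s : ℝ) : ℂ) * Complex.I)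

theorem norm_wave (v s : Euc d) : ‖wave v s‖ = 1 := Complex.norm_exp_ofReal_mul_I _

theorem wave_add_left (v w s : Euc d) : wave (v + w) s = wave v s * wave w s := by
  rw [wave, wave, wave, ← Complex.exp_add, inner_add_left]
  push_cast
  ring_nf

theorem wave_zero_left (s : Euc d) : wave 0 s = 1 := by simp [wave]

theorem conj_wave (v s : Euc d) : (starRingEnd ℂ) (wave v s) = wave (-v) s := by
  rw [wave, wave, ← Complex.exp_conj, map_mul, Complex.conj_ofReal, Complex.conj_I, inner_neg_left]
  push_cast
  ring_nf

theorem wave_act (M : Matrix (Fin d) (Fin d) ℝ) (v s : Euc d) :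
    wave (act M v) s = wave v (act M.transpose s) := by
  rw [wave, wave, inner_act]

theorem continuous_wave (v : Euc d) : Continuous (wave v) := by
  unfold wave
  fun_prop

theorem memLp_wave_mul (v : Euc d) {f : Euc d → ℂ} (hf : MemLp f 2 volume) :
    MemLp (fun s => wave v s * f s) 2 volume :=
  hf.of_le ((continuous_wave v).aestronglyMeasurable.mul hf.1)
    (Filter.Eventually.of_forall fun s => by simp [norm_wave])

/-- Multiplication by the character `exp(-2πi v·s)` on `L²`. -/
def modulation (v : Euc d) : L2 d →ₗᵢ[ℂ] L2 d where
  toFun f := (memLp_wave_mul v (Lp.memLp f)).toLp _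
  map_add' f g := by
    apply Lp.ext
    filter_upwards [(memLp_wave_mul v (Lp.memLp (f + g))).coeFn_toLp,
      Lp.coeFn_add ((memLp_wave_mul v (Lp.memLp f)).toLp _)
        ((memLp_wave_mul v (Lp.memLp g)).toLp _),
      (memLp_wave_mul v (Lp.memLp f)).coeFn_toLp,
      (memLp_wave_mul v (Lp.memLp g)).coeFn_toLp, Lp.coeFn_add f g] with t h1 h2 h3 h4 h5
    rw [h1, h2, Pi.add_apply, h3, h4, h5, Pi.add_apply, mul_add]
  map_smul' c f := by
    apply Lp.ext
    filter_upwards [(memLp_wave_mul v (Lp.memLp (c • f))).coeFn_toLp,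
      Lp.coeFn_smul c ((memLp_wave_mul v (Lp.memLp f)).toLp _),
      (memLp_wave_mul v (Lp.memLp f)).coeFn_toLp, Lp.coeFn_smul c f] with t h1 h2 h3 h4
    rw [h1, RingHom.id_apply, h2, Pi.smul_apply, h3, h4, Pi.smul_apply, smul_eq_mul, smul_eq_mul]
    ring
  norm_map' f := by
    change ‖(memLp_wave_mul v (Lp.memLp f)).toLp _‖ = ‖f‖
    rw [Lp.norm_toLp, Lp.norm_def]
    congr 1
    exact eLpNorm_congr_norm_ae (Filter.Eventually.of_forall fun s => by simp [norm_wave])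

theorem coeFn_modulation (v : Euc d) (f : L2 d) :
    (modulation v f : Euc d → ℂ) =ᵐ[volume] fun s => wave v s * f s :=
  (memLp_wave_mul v (Lp.memLp f)).coeFn_toLp

/-- Identities between continuous operators on `L²` need checking only on Schwartz functions, where
the Fourier transform is an integral. -/
theorem dense_schwartz (p : L2 d → Prop) (hp : IsClosed {f | p f})
    (h : ∀ f : SchwartzMap (Euc d) ℂ, p (f.toLp 2)) (f : L2 d) : p f :=
  DenseRange.induction_on (p := p)
    (SchwartzMap.denseRange_toLpCLM (p := 2) (F := ℂ) (E := Euc d) (μ := volume)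
      ENNReal.ofNat_ne_top) f hp h

theorem FT_toLp (f : SchwartzMap (Euc d) ℂ) :
    FT d (f.toLp 2) = (FourierTransform.fourier f : SchwartzMap (Euc d) ℂ).toLp 2 := by
  rw [← SchwartzMap.toLp_fourier_eq]
  rfl

theorem fourier_eq_wave (f : Euc d → ℂ) (s : Euc d) :
    FourierTransform.fourier f s = ∫ t, wave t s * f t := by
  rw [Real.fourier_eq']
  rfl

theorem FT_translation (v : Euc d) (f : L2 d) :
    FT d (translation v f) = modulation v (FT d f) := by
  refine dense_schwartz (fun f => FT d (translation v f) = modulation v (FT d f)) ?_ ?_ f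
  · exact isClosed_eq ((FT d).continuous.comp (translation v).continuous)
      ((modulation v).continuous.comp (FT d).continuous)
  intro f
  have h1 : translation v (f.toLp 2) = (f.compSubConstCLM ℂ v).toLp 2 := by
    apply Lp.ext
    filter_upwards [coeFn_translation v (f.toLp 2), SchwartzMap.coeFn_toLp (f.compSubConstCLM ℂ v) 2,
      sub_ae_comp v (SchwartzMap.coeFn_toLp f 2 volume)] with t h1 h2 h3
    rw [h1, h2, h3, SchwartzMap.compSubConstCLM_apply]
  rw [h1, FT_toLp, FT_toLp]
  apply Lp.ext
  filter_upwards [SchwartzMap.coeFn_toLp (FourierTransform.fourier (f.compSubConstCLM ℂ v)) 2,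
    coeFn_modulation v ((FourierTransform.fourier f : SchwartzMap (Euc d) ℂ).toLp 2),
    SchwartzMap.coeFn_toLp (FourierTransform.fourier f : SchwartzMap (Euc d) ℂ) 2] with s h1 h2 h3
  rw [h1, h2, h3, SchwartzMap.fourier_coe, SchwartzMap.fourier_coe, fourier_eq_wave,
    fourier_eq_wave, ← integral_const_mul,
    ← integral_sub_right_eq_self (fun t => wave v s * (wave t s * f t)) v]
  congr 1
  ext t
  rw [SchwartzMap.compSubConstCLM_apply, ← mul_assoc, ← wave_add_left]
  congr 2
  abel

theorem integral_comp_act {M : Matrix (Fin d) (Fin d) ℝ} (hM : M.det ≠ 0) (f : Euc d → ℂ)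
    (hf : AEStronglyMeasurable f volume) :
    ∫ t, f (act M t) = (|M.det⁻¹| : ℝ) * ∫ t, f t := by
  have hf' : AEStronglyMeasurable f (Measure.map (act M) volume) := by
    rw [map_act_volume hM]; exact hf.smul_measure _
  rw [← integral_map (measurable_act M).aemeasurable hf', map_act_volume hM, integral_smul_measure,
    ENNReal.toReal_ofReal (abs_nonneg _)]
  exact Complex.real_smul

theorem FT_dilation {M : Matrix (Fin d) (Fin d) ℝ} (hM : M.det ≠ 0) (f : L2 d) :
    FT d (dilation M f) = dilation M.transpose⁻¹ (FT d f) := by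
  have hu : IsUnit M.det := isUnit_iff_ne_zero.mpr hM
  have hT : IsUnit M.transpose.det := by rwa [Matrix.det_transpose]
  refine dense_schwartz (fun f => FT d (dilation M f) = dilation M.transpose⁻¹ (FT d f)) ?_ ?_ f
  · exact isClosed_eq ((FT d).continuous.comp (dilation M).continuous)
      ((dilation _).continuous.comp (FT d).continuous)
  intro f
  let e : Euc d ≃L[ℝ] Euc d := ContinuousLinearEquiv.equivOfInverse
    (LinearMap.toContinuousLinearMap (Matrix.toEuclideanLin M))
    (LinearMap.toContinuousLinearMap (Matrix.toEuclideanLin M⁻¹))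
    (fun t => by
      change act M⁻¹ (act M t) = t
      rw [act_mul, Matrix.nonsing_inv_mul _ hu, act_one])
    (fun t => by
      change act M (act M⁻¹ t) = t
      rw [act_mul, Matrix.mul_nonsing_inv _ hu, act_one])
  let g : SchwartzMap (Euc d) ℂ := SchwartzMap.compCLMOfContinuousLinearEquiv ℂ e f
  have hg : ∀ t, g t = f (act M t) := fun t => rfl
  have h1 : dilation M (f.toLp 2) = (Real.sqrt |M.det| : ℂ) • g.toLp 2 volume := by
    apply Lp.ext
    filter_upwards [coeFn_dilation hM (f.toLp 2), SchwartzMap.coeFn_toLp g 2 volume,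
      act_ae_comp hM (SchwartzMap.coeFn_toLp f 2 volume),
      Lp.coeFn_smul (Real.sqrt |M.det| : ℂ) (g.toLp 2 volume)] with t h1 h2 h3 h4
    rw [h1, h4, Pi.smul_apply, h2, h3, hg, smul_eq_mul]
  rw [h1, map_smul, FT_toLp, FT_toLp]
  apply Lp.ext
  filter_upwards [Lp.coeFn_smul (Real.sqrt |M.det| : ℂ)
      ((FourierTransform.fourier g : SchwartzMap (Euc d) ℂ).toLp 2),
    SchwartzMap.coeFn_toLp (FourierTransform.fourier g : SchwartzMap (Euc d) ℂ) 2,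
    coeFn_dilation (det_transpose_inv_ne_zero hM)
      ((FourierTransform.fourier f : SchwartzMap (Euc d) ℂ).toLp 2),
    act_ae_comp (det_transpose_inv_ne_zero hM)
      (SchwartzMap.coeFn_toLp (FourierTransform.fourier f : SchwartzMap (Euc d) ℂ) 2 volume)]
    with s h1 h2 h3 h4
  have hint : ∫ t, wave t s * g t = (|M.det⁻¹| : ℝ) * ∫ t, wave t (act M.transpose⁻¹ s) * f t := by
    rw [← integral_comp_act hM]
    · congr 1
      ext t
      rw [wave_act, act_mul, Matrix.mul_nonsing_inv _ hT, act_one, hg]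
    · refine Continuous.aestronglyMeasurable ?_
      unfold wave
      have := f.continuous
      fun_prop
  rw [h1, Pi.smul_apply, h2, h3, h4, SchwartzMap.fourier_coe, SchwartzMap.fourier_coe,
    fourier_eq_wave, fourier_eq_wave, hint, smul_eq_mul, ← mul_assoc]
  congr 1
  -- The factor `√|det M|` of the dilation times the Jacobian `|det M|⁻¹` is the factor `|det
  -- M|^(-1/2)` of the dual dilation.
  rw [Matrix.det_nonsing_inv, Matrix.det_transpose, Ring.inverse_eq_inv', abs_inv, Real.sqrt_inv]
  have h0 : 0 < |M.det| := abs_pos.mpr hM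
  norm_cast
  rw [← div_eq_mul_inv, Real.sqrt_div_self']
  simp

/-! ### Contraction -/

/-- The powers of `M` contract `ℝ^d` at a geometric rate. -/
def IsContracting (M : Matrix (Fin d) (Fin d) ℝ) : Prop :=
  ∃ C r : ℝ, 0 ≤ C ∧ 0 ≤ r ∧ r < 1 ∧ ∀ (n : ℕ) (t : Euc d), ‖act (M ^ n) t‖ ≤ C * r ^ n * ‖t‖

theorem norm_act_le {M : Matrix (Fin d) (Fin d) ℝ} {c : ℝ} (hM : ∀ i j, |M i j| ≤ c) (t : Euc d) :
    ‖act M t‖ ≤ d * (d * c) * ‖t‖ := by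
  have h1 : ∀ i, ‖act M t i‖ ≤ d * c * ‖t‖ := by
    intro i
    change ‖∑ j, M i j * t j‖ ≤ _
    refine (norm_sum_le _ _).trans ?_
    calc ∑ j, ‖M i j * t j‖ ≤ ∑ j : Fin d, c * ‖t‖ := by
          refine Finset.sum_le_sum fun j _ => ?_
          rw [norm_mul]
          have := PiLp.norm_apply_le t j
          have h0 := (abs_nonneg _).trans (hM i j)
          have := hM i j
          rw [Real.norm_eq_abs (M i j)]
          gcongr
      _ = d * c * ‖t‖ := by simp [mul_assoc]
  have h2 : ‖act M t‖ ≤ ∑ i, ‖act M t i‖ := by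
    have h3 : act M t = ∑ i, EuclideanSpace.single i (act M t i) := by
      ext j
      simp
    conv_lhs => rw [h3]
    refine (norm_sum_le _ _).trans (le_of_eq ?_)
    simp
  refine h2.trans ((Finset.sum_le_sum fun i _ => h1 i).trans (le_of_eq ?_))
  simp [mul_assoc]

theorem isContracting_of_entries {M : Matrix (Fin d) (Fin d) ℝ} {C r : ℝ} (hC : 0 ≤ C) (hr : 0 ≤ r)
    (hr1 : r < 1) (h : ∀ (n : ℕ) i j, |(M ^ n) i j| ≤ C * r ^ n) : IsContracting M :=
  ⟨d * (d * C), r, by positivity, hr, hr1, fun n t => by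
    refine (norm_act_le (h n) t).trans (le_of_eq ?_)
    ring⟩

-- Gelfand's formula: `‖aⁿ‖^(1/n)` tends to the spectral radius, which is below `1`, so any `r`
-- strictly between works for large `n`; the constant absorbs the remaining `n`.
open scoped Matrix.Norms.Operator in
theorem exists_norm_pow_le_of_spectrum (a : Matrix (Fin d) (Fin d) ℂ)
    (ha : ∀ z ∈ spectrum ℂ a, ‖z‖ < 1) :
    ∃ C r : ℝ, 0 ≤ C ∧ 0 ≤ r ∧ r < 1 ∧ ∀ (n : ℕ) i j, ‖(a ^ n) i j‖ ≤ C * r ^ n := by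
  rcases Nat.eq_zero_or_pos d with rfl | hd
  · exact ⟨0, 0, le_rfl, le_rfl, one_pos, fun n i => i.elim0⟩
  have : Nonempty (Fin d) := ⟨⟨0, hd⟩⟩
  have hne : (spectrum ℂ a).Nonempty := spectrum.nonempty a
  have hρ : spectralRadius ℂ a < (1 : NNReal) :=
    spectrum.spectralRadius_lt_of_forall_lt_of_nonempty hne fun z hz => ha z hz
  obtain ⟨r, hr1, hr2⟩ := ENNReal.lt_iff_exists_nnreal_btwn.mp hρ
  have hrpos : 0 < r := by
    rw [← ENNReal.coe_pos]; exact bot_le.trans_lt hr1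
  have hev := (spectrum.pow_nnnorm_pow_one_div_tendsto_nhds_spectralRadius a).eventually_lt_const hr1
  have hO : (fun n : ℕ => ‖a ^ n‖) =O[Filter.atTop] (fun n : ℕ => (r : ℝ) ^ n) := by
    refine Asymptotics.IsBigO.of_bound 1 ?_
    filter_upwards [hev, Filter.eventually_gt_atTop 0] with n hn hn0
    have hn0' : (0 : ℝ) < n := Nat.cast_pos.mpr hn0
    have h1 : (‖a ^ n‖₊ : ENNReal) ≤ (r : ENNReal) ^ (n : ℝ) := by
      have := ENNReal.rpow_le_rpow hn.le hn0'.le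
      rwa [← ENNReal.rpow_mul, one_div, inv_mul_cancel₀ hn0'.ne', ENNReal.rpow_one] at this
    rw [ENNReal.rpow_natCast, ← ENNReal.coe_pow, ENNReal.coe_le_coe] at h1
    have h2 : ‖a ^ n‖ ≤ (r : ℝ) ^ n := by exact_mod_cast h1
    simpa using h2
  obtain ⟨C, hC, hb⟩ := Asymptotics.bound_of_isBigO_nat_atTop hO
  refine ⟨C, r, hC.le, r.2, by exact_mod_cast hr2, fun n i j => ?_⟩
  have h1 := hb (x := n) (by positivity)
  have h2 : ‖(a ^ n) i j‖₊ ≤ ‖a ^ n‖₊ := by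
    rw [Matrix.linfty_opNNNorm_def]
    refine le_trans ?_ (Finset.le_sup (f := fun i => ∑ j, ‖(a ^ n) i j‖₊) (Finset.mem_univ i))
    exact Finset.single_le_sum (f := fun j => ‖(a ^ n) i j‖₊) (fun _ _ => zero_le)
      (Finset.mem_univ j)
  have h3 : ‖(a ^ n) i j‖ ≤ ‖a ^ n‖ := by exact_mod_cast h2
  rw [norm_norm] at h1
  refine h3.trans (h1.trans (le_of_eq ?_))
  simp

theorem hasEigenvalue_iff_mem_spectrum_map (A : Matrix (Fin d) (Fin d) ℤ) (β : ℂ) :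
    Module.End.HasEigenvalue (Matrix.toLin' (A.map (fun a : ℤ => (a : ℂ)))) β ↔
      β ∈ spectrum ℂ (A.map (fun a : ℤ => (a : ℂ))) := by
  rw [Module.End.hasEigenvalue_iff_mem_spectrum, Matrix.spectrum_toLin']

/-- The eigenvalues of `A⁻¹` are the inverses of those of `A`, hence lie in the open unit disc. A
bound on entries serves `A⁻¹` and its transpose alike. -/
theorem exists_entries_inv_pow_le {A : Matrix (Fin d) (Fin d) ℤ} (hA : IsExpansive A)
    (hdet : A.det ≠ 0) :
    ∃ C r : ℝ, 0 ≤ C ∧ 0 ≤ r ∧ r < 1 ∧ ∀ (n : ℕ) i j, |((toReal A)⁻¹ ^ n) i j| ≤ C * r ^ n := by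
  let ι : Matrix (Fin d) (Fin d) ℝ →+* Matrix (Fin d) (Fin d) ℂ := Complex.ofRealHom.mapMatrix
  have hu : IsUnit (toReal A).det := by
    rw [det_toReal]; exact isUnit_iff_ne_zero.mpr (by exact_mod_cast hdet)
  have hAC : A.map (fun a : ℤ => (a : ℂ)) = ι (toReal A) := by
    ext i j; simp [ι, toReal]
  let u : (Matrix (Fin d) (Fin d) ℂ)ˣ :=
    ⟨ι (toReal A), ι (toReal A)⁻¹, by rw [← map_mul, Matrix.mul_nonsing_inv _ hu, map_one],
      by rw [← map_mul, Matrix.nonsing_inv_mul _ hu, map_one]⟩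
  obtain ⟨C, r, hC, hr, hr1, h⟩ := exists_norm_pow_le_of_spectrum (ι (toReal A)⁻¹) (by
    intro z hz
    have hz0 : z ≠ 0 := by
      rintro rfl
      exact spectrum.zero_notMem ℂ (u⁻¹).isUnit hz
    have h1 : (Units.mk0 z hz0 : ℂ) ∈ spectrum ℂ ((u⁻¹ : (Matrix (Fin d) (Fin d) ℂ)ˣ) :
      Matrix (Fin d) (Fin d) ℂ) := hz
    rw [spectrum.inv_mem_iff, inv_inv, Units.val_inv_eq_inv_val, Units.val_mk0] at h1
    have h2 := hA z⁻¹ ((hasEigenvalue_iff_mem_spectrum_map A _).mpr (hAC ▸ h1))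
    rw [norm_inv] at h2
    exact (one_lt_inv₀ (norm_pos_iff.mpr hz0)).mp h2)
  refine ⟨C, r, hC, hr, hr1, fun n i j => ?_⟩
  have h1 := h n i j
  rw [← map_pow] at h1
  simpa [ι] using h1

theorem IsExpansive.isContracting_inv {A : Matrix (Fin d) (Fin d) ℤ} (hA : IsExpansive A)
    (hdet : A.det ≠ 0) : IsContracting (toReal A)⁻¹ := by
  obtain ⟨C, r, hC, hr, hr1, h⟩ := exists_entries_inv_pow_le hA hdet
  exact isContracting_of_entries hC hr hr1 h

theorem IsExpansive.isContracting_transpose_inv {A : Matrix (Fin d) (Fin d) ℤ}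
    (hA : IsExpansive A) (hdet : A.det ≠ 0) : IsContracting (toReal A).transpose⁻¹ := by
  obtain ⟨C, r, hC, hr, hr1, h⟩ := exists_entries_inv_pow_le hA hdet
  refine isContracting_of_entries hC hr hr1 fun n i j => ?_
  rw [← Matrix.transpose_nonsing_inv, ← Matrix.transpose_pow]
  exact h n j i

theorem PartitionData.isExpansive {A₀ A S : Matrix (Fin d) (Fin d) ℤ} {l q : Fin d → ℤ}
    (hP : PartitionData A₀ A S l q) (hA : IsExpansive A₀) : IsExpansive A := by
  intro β hβ
  apply hA β
  rw [hasEigenvalue_iff_mem_spectrum_map] at hβ ⊢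
  let ι : Matrix (Fin d) (Fin d) ℤ →+* Matrix (Fin d) (Fin d) ℂ := (Int.castRingHom ℂ).mapMatrix
  have hu := hP.isUnit_det_S
  let u : (Matrix (Fin d) (Fin d) ℂ)ˣ :=
    ⟨ι S, ι S⁻¹, by rw [← map_mul, Matrix.mul_nonsing_inv _ hu, map_one],
      by rw [← map_mul, Matrix.nonsing_inv_mul _ hu, map_one]⟩
  have h1 : A₀.map (fun a : ℤ => (a : ℂ)) = ((u⁻¹ : (Matrix (Fin d) (Fin d) ℂ)ˣ) :
      Matrix (Fin d) (Fin d) ℂ) * A.map (fun a : ℤ => (a : ℂ)) * (u : Matrix (Fin d) (Fin d) ℂ) := by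
    change ι A₀ = ι S⁻¹ * ι A * ι S
    rw [← map_mul, ← map_mul, ← hP.similar]
  rw [h1, spectrum.units_conjugate']
  exact hβ

theorem PartitionData.det_eq {A₀ A S : Matrix (Fin d) (Fin d) ℤ} {l q : Fin d → ℤ}
    (hP : PartitionData A₀ A S l q) : A₀.det = A.det := by
  have h1 : S⁻¹.det * S.det = 1 := by
    rw [← Matrix.det_mul, Matrix.nonsing_inv_mul _ hP.isUnit_det_S, Matrix.det_one]
  rw [hP.similar, Matrix.det_mul, Matrix.det_mul, mul_right_comm, h1, one_mul]

/-! ### Infinite products of a mask -/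

/-- The infinite product `∏_{j ≥ 1} m (M^j s)`. -/
def maskProd (M : Matrix (Fin d) (Fin d) ℝ) (m : Euc d → ℂ) (s : Euc d) : ℂ :=
  ∏' j : ℕ, m (act (M ^ (j + 1)) s)

section MaskProd

variable {M : Matrix (Fin d) (Fin d) ℝ} {m : Euc d → ℂ}

/-- The mask deviates from `1` at most linearly and its arguments shrink geometrically, so the
deviations are summable, with a bound linear in `‖s‖`. -/
theorem exists_summable_bound (hM : IsContracting M) {K : ℝ} (hK : 0 ≤ K)
    (hm : ∀ s, ‖m s - 1‖ ≤ K * ‖s‖) :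
    ∃ a : ℕ → ℝ, Summable a ∧ (∀ j, 0 ≤ a j) ∧
      ∀ s j, ‖m (act (M ^ (j + 1)) s) - 1‖ ≤ a j * ‖s‖ := by
  obtain ⟨C, r, hC, hr, hr1, h⟩ := hM
  refine ⟨fun j => K * C * r * r ^ j, (summable_geometric_of_lt_one hr hr1).mul_left _,
    fun j => by positivity, fun s j => ?_⟩
  refine (hm _).trans ((mul_le_mul_of_nonneg_left (h (j + 1) s) hK).trans (le_of_eq ?_))
  ring

theorem multipliable_mask (hM : IsContracting M) {K : ℝ} (hK : 0 ≤ K)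
    (hm : ∀ s, ‖m s - 1‖ ≤ K * ‖s‖) (s : Euc d) :
    Multipliable fun j : ℕ => m (act (M ^ (j + 1)) s) := by
  obtain ⟨a, ha, ha0, hb⟩ := exists_summable_bound hM hK hm
  have := multipliable_one_add_of_summable (f := fun j : ℕ => m (act (M ^ (j + 1)) s) - 1)
    ((ha.mul_right ‖s‖).of_nonneg_of_le (fun _ => norm_nonneg _) (hb s))
  simpa using this

theorem tendsto_maskProd (hM : IsContracting M) {K : ℝ} (hK : 0 ≤ K)
    (hm : ∀ s, ‖m s - 1‖ ≤ K * ‖s‖) (s : Euc d) :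
    Filter.Tendsto (fun J : ℕ => ∏ j ∈ Finset.range J, m (act (M ^ (j + 1)) s)) Filter.atTop
      (nhds (maskProd M m s)) :=
  (multipliable_mask hM hK hm s).hasProd.tendsto_prod_nat

/-- From `|∏ (1 + u_j) - 1| ≤ exp (∑ |u_j|) - 1` for the partial products. The bound is uniform in
their length, so it gives continuity of the limit at the origin. -/
theorem exists_norm_maskProd_sub_one_le (hM : IsContracting M) {K : ℝ} (hK : 0 ≤ K)
    (hm : ∀ s, ‖m s - 1‖ ≤ K * ‖s‖) :
    ∃ L : ℝ, ∀ s, ‖maskProd M m s - 1‖ ≤ Real.exp (L * ‖s‖) - 1 := by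
  obtain ⟨a, ha, ha0, hb⟩ := exists_summable_bound hM hK hm
  refine ⟨∑' j, a j, fun s => ?_⟩
  refine le_of_tendsto ((tendsto_maskProd hM hK hm s).sub_const 1).norm
    (Filter.Eventually.of_forall fun J => ?_)
  have h1 := Finset.norm_prod_one_add_sub_one_le (Finset.range J)
    (fun j => m (act (M ^ (j + 1)) s) - 1)
  simp only [add_sub_cancel] at h1
  refine h1.trans (sub_le_sub_right (Real.exp_le_exp.mpr ?_) 1)
  refine (Finset.sum_le_sum fun j _ => hb s j).trans ?_
  rw [← Finset.sum_mul]
  exact mul_le_mul_of_nonneg_right (ha.sum_le_tsum _ fun j _ => ha0 j) (norm_nonneg s)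

/-- The infinite product is close to `1` near the origin. -/
theorem tendsto_maskProd_zero (hM : IsContracting M) {K : ℝ} (hK : 0 ≤ K)
    (hm : ∀ s, ‖m s - 1‖ ≤ K * ‖s‖) :
    Filter.Tendsto (maskProd M m) (nhds 0) (nhds 1) := by
  obtain ⟨L, hL⟩ := exists_norm_maskProd_sub_one_le hM hK hm
  rw [tendsto_iff_norm_sub_tendsto_zero]
  refine squeeze_zero (fun _ => norm_nonneg _) hL ?_
  have h : Continuous fun s : Euc d => Real.exp (L * ‖s‖) - 1 := by fun_prop
  have := h.tendsto 0
  simpa using this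

/-- Splitting off the first factor gives the Fourier form of the refinement equation. -/
theorem maskProd_eq_mul (hM : IsContracting M) {K : ℝ} (hK : 0 ≤ K)
    (hm : ∀ s, ‖m s - 1‖ ≤ K * ‖s‖) (s : Euc d) :
    maskProd M m s = m (act M s) * maskProd M m (act M s) := by
  have h : (fun j : ℕ => m (act (M ^ (j + 1 + 1)) s))
      = fun j : ℕ => m (act (M ^ (j + 1)) (act M s)) := by
    ext j
    rw [act_mul, ← pow_succ]
  have h2 := multipliable_mask hM hK hm (act M s)
  rw [← h] at h2
  rw [maskProd, tprod_eq_zero_mul' h2, maskProd, h, zero_add, pow_one]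

theorem aestronglyMeasurable_maskProd (hM : IsContracting M) {K : ℝ} (hK : 0 ≤ K)
    (hm : ∀ s, ‖m s - 1‖ ≤ K * ‖s‖) (hmc : Continuous m) :
    AEStronglyMeasurable (maskProd M m) (volume : Measure (Euc d)) := by
  refine aestronglyMeasurable_of_tendsto_ae Filter.atTop
    (f := fun (J : ℕ) s => ∏ j ∈ Finset.range J, m (act (M ^ (j + 1)) s)) (fun J => ?_)
    (Filter.Eventually.of_forall fun s => tendsto_maskProd hM hK hm s)
  refine Continuous.aestronglyMeasurable ?_
  exact continuous_finsetProd _ fun j _ => hmc.comp (continuous_act _)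

end MaskProd

/-! ### The mask of a finite filter -/

/-- The mask `s ↦ m₀(2π s) = (1/√2) ∑ h_n exp(-2πi n·s)`. -/
def mask (N : ℕ) (h : (Fin d → ℤ) → ℂ) (s : Euc d) : ℂ :=
  (1 / Real.sqrt 2 : ℝ) * ∑ n ∈ box d N, h n * wave (intVec n) s

theorem continuous_mask (N : ℕ) (h : (Fin d → ℤ) → ℂ) : Continuous (mask N h) := by
  unfold mask
  exact continuous_const.mul (continuous_finsetSum _ fun n _ =>
    continuous_const.mul (continuous_wave _))

section Lawton

variable {A : Matrix (Fin d) (Fin d) ℤ} {N : ℕ} {h : (Fin d → ℤ) → ℂ}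

theorem IsFiniteLawtonSolution.support_subset (hh : IsFiniteLawtonSolution A N h)
    {β : Type*} [AddCommMonoid β] (F : (Fin d → ℤ) → β) (hF : ∀ n, h n = 0 → F n = 0) :
    Function.support F ⊆ (box d N : Set (Fin d → ℤ)) := by
  intro n hn
  by_contra hnb
  exact hn (hF n (hh.finite n hnb))

theorem IsFiniteLawtonSolution.sum_eq (hh : IsFiniteLawtonSolution A N h) :
    ∑ n ∈ box d N, h n = (Real.sqrt 2 : ℂ) := by
  rw [← hh.normalization]
  exact (finsum_eq_sum_of_support_subset _ (hh.support_subset _ fun n hn => hn)).symm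

theorem IsFiniteLawtonSolution.filterFun_eq_mask (hh : IsFiniteLawtonSolution A N h) (t : Euc d) :
    filterFun h t = mask N h ((2 * Real.pi)⁻¹ • t) := by
  rw [filterFun, mask]
  congr 1
  rw [finsum_eq_sum_of_support_subset _ (hh.support_subset _ fun n hn => by rw [hn, zero_mul])]
  refine Finset.sum_congr rfl fun n _ => ?_
  congr 1
  rw [wave]
  congr 1
  have h1 : (inner ℝ (intVec n) ((2 * Real.pi)⁻¹ • t) : ℝ)
      = (2 * Real.pi)⁻¹ * ∑ i, (n i : ℝ) * t i := by
    rw [inner_smul_right, PiLp.inner_apply]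
    congr 1
    refine Finset.sum_congr rfl fun i _ => ?_
    simp [intVec, mul_comm]
  rw [h1]
  have h2 : (-2 * Real.pi * ((2 * Real.pi)⁻¹ * ∑ i, (n i : ℝ) * t i) : ℝ)
      = -∑ i, (n i : ℝ) * t i := by
    have := Real.pi_ne_zero
    field_simp
  rw [h2, Complex.ofReal_neg]
  ring

theorem norm_wave_sub_one_le (v s : Euc d) : ‖wave v s - 1‖ ≤ 2 * Real.pi * ‖v‖ * ‖s‖ := by
  have h1 := Real.norm_exp_I_mul_ofReal_sub_one_le (x := -2 * Real.pi * inner ℝ v s)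
  rw [mul_comm Complex.I] at h1
  refine h1.trans ?_
  rw [norm_mul, Real.norm_eq_abs (-2 * Real.pi), Real.norm_eq_abs (inner ℝ v s),
    show |(-2 * Real.pi)| = 2 * Real.pi by
      rw [neg_mul, abs_neg, abs_of_pos (by positivity)], mul_assoc (2 * Real.pi)]
  exact mul_le_mul_of_nonneg_left (abs_real_inner_le_norm v s) (by positivity)

/-- The normalization `∑ h_n = √2` says that the mask equals `1` at the origin, and a trigonometric
polynomial is Lipschitz. -/
theorem IsFiniteLawtonSolution.exists_mask_bound (hh : IsFiniteLawtonSolution A N h) :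
    ∃ K : ℝ, 0 ≤ K ∧ ∀ s, ‖mask N h s - 1‖ ≤ K * ‖s‖ := by
  have hs : (0 : ℝ) < Real.sqrt 2 := by positivity
  refine ⟨1 / Real.sqrt 2 * ∑ n ∈ box d N, ‖h n‖ * (2 * Real.pi * ‖intVec n‖), by positivity,
    fun s => ?_⟩
  have h1 : mask N h s - 1
      = (1 / Real.sqrt 2 : ℝ) * ∑ n ∈ box d N, h n * (wave (intVec n) s - 1) := by
    simp only [mask, mul_sub, mul_one, Finset.sum_sub_distrib, hh.sum_eq]
    congr 1
    rw [← Complex.ofReal_mul, one_div, inv_mul_cancel₀ hs.ne', Complex.ofReal_one]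
  rw [h1, norm_mul, Complex.norm_real, Real.norm_of_nonneg (by positivity), mul_assoc]
  refine mul_le_mul_of_nonneg_left ?_ (by positivity)
  rw [Finset.sum_mul]
  refine (norm_sum_le _ _).trans (Finset.sum_le_sum fun n _ => ?_)
  rw [norm_mul, mul_assoc]
  exact mul_le_mul_of_nonneg_left (norm_wave_sub_one_le _ _) (norm_nonneg _)

theorem act_smul (M : Matrix (Fin d) (Fin d) ℝ) (c : ℝ) (t : Euc d) :
    act M (c • t) = c • act M t := by
  rw [act_eq_toEuclideanLin, map_smul]

theorem IsFiniteLawtonSolution.factor_eq (hh : IsFiniteLawtonSolution A N h) (ξ : Euc d) (j : ℕ) :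
    factor A h ξ j = mask N h (act ((toReal A).transpose⁻¹ ^ (j + 1)) ((2 * Real.pi)⁻¹ • ξ)) := by
  rw [factor, hh.filterFun_eq_mask, act_smul]

theorem IsFiniteLawtonSolution.multipliable_factor (hh : IsFiniteLawtonSolution A N h)
    (hA : IsContracting (toReal A).transpose⁻¹) (ξ : Euc d) : Multipliable (factor A h ξ) := by
  obtain ⟨K, hK, hm⟩ := hh.exists_mask_bound
  have := multipliable_mask hA hK hm ((2 * Real.pi)⁻¹ • ξ)
  rwa [show factor A h ξ = _ from funext (hh.factor_eq ξ)]

theorem det_scaleMatrix_ne_zero :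
    ((2 * Real.pi)⁻¹ • (1 : Matrix (Fin d) (Fin d) ℝ)).det ≠ 0 := by
  rw [Matrix.det_smul, Matrix.det_one, mul_one]
  positivity

/-- The constant `(2π)^(-d/2)` is the unitary factor of the rescaling by `(2π)⁻¹`, so it disappears
when `φ_A` is transformed with the normalization `exp(-2πi s·t)`. -/
theorem IsFiniteLawtonSolution.scalingFourier_eq (hh : IsFiniteLawtonSolution A N h) :
    scalingFourier A h = dilateFun ((2 * Real.pi)⁻¹ • (1 : Matrix (Fin d) (Fin d) ℝ))
      (maskProd (toReal A).transpose⁻¹ (mask N h)) := by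
  have hpi : (0 : ℝ) < 2 * Real.pi := by positivity
  have hc : Real.sqrt |((2 * Real.pi)⁻¹ • (1 : Matrix (Fin d) (Fin d) ℝ)).det|
      = (2 * Real.pi) ^ (-(d : ℝ) / 2) := by
    rw [Matrix.det_smul, Matrix.det_one, mul_one, Fintype.card_fin,
      abs_of_nonneg (by positivity), Real.sqrt_eq_rpow, ← Real.rpow_natCast,
      Real.inv_rpow hpi.le, ← Real.rpow_neg hpi.le, ← Real.rpow_mul hpi.le]
    ring_nf
  ext ξ
  rw [scalingFourier, dilateFun, hc, maskProd]
  congr 1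
  refine tprod_congr fun j => ?_
  rw [hh.factor_eq]
  congr 2
  ext i
  simp [act, Matrix.smul_mulVec]

end Lawton

/-! ### Fourier series on the unit cube -/

section FourierSeries

attribute [local instance] instMeasureSpaceUnitAddCircle
  instIsProbabilityMeasureUnitAddCircleVolume

/-- The unit cube `(-1/2, 1/2]^d`. -/
def cube (d : ℕ) : Set (Euc d) := {s | ∀ i, s i ∈ Set.Ioc (-1 / 2 : ℝ) (-1 / 2 + 1)}

theorem measurableSet_cube : MeasurableSet (cube d) := by
  have h : cube d = ⋂ i, (fun s : Euc d => s i) ⁻¹' Set.Ioc (-1 / 2 : ℝ) (-1 / 2 + 1) := by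
    ext s; simp [cube]
  rw [h]
  refine MeasurableSet.iInter fun i => measurableSet_Ioc.preimage ?_
  fun_prop

theorem ball_subset_cube : Metric.ball (0 : Euc d) (1 / 2) ⊆ cube d := by
  intro s hs i
  rw [mem_ball_zero_iff] at hs
  have h1 := (PiLp.norm_apply_le s i).trans_lt hs
  rw [Real.norm_eq_abs, abs_lt] at h1
  constructor <;> linarith [h1.1, h1.2]

/-- The representative in the cube of a point of the torus. -/
def torusLift (x : UnitAddTorus (Fin d)) : Euc d :=
  WithLp.toLp 2 (UnitAddTorus.measurableEquivPiIoc (fun _ => -1 / 2) x).1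

theorem measurePreserving_torusLift :
    MeasurePreserving (torusLift : UnitAddTorus (Fin d) → Euc d) volume
      (volume.restrict (cube d)) := by
  have h1 := UnitAddTorus.measurePreserving_equivPiIoc (d := Fin d) (fun _ => (-1 / 2 : ℝ))
  have hms : MeasurableSet {x : Fin d → ℝ | ∀ i, x i ∈ Set.Ioc (-1 / 2 : ℝ) (-1 / 2 + 1)} :=
    MeasurableSet.univ_pi' fun _ => measurableSet_Ioc
  have h2 : MeasurePreserving
      (Subtype.val : {x : Fin d → ℝ // ∀ i, x i ∈ Set.Ioc (-1 / 2 : ℝ) (-1 / 2 + 1)} → Fin d → ℝ)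
      (Measure.comap Subtype.val volume)
      (volume.restrict {x : Fin d → ℝ | ∀ i, x i ∈ Set.Ioc (-1 / 2 : ℝ) (-1 / 2 + 1)}) :=
    ⟨measurable_subtype_coe, map_comap_subtype_coe hms volume⟩
  have h3 := (PiLp.volume_preserving_toLp (Fin d)).restrict_preimage measurableSet_cube
  exact h3.comp (h2.comp h1)

theorem coe_torusLift (x : UnitAddTorus (Fin d)) (i : Fin d) :
    ((torusLift x i : ℝ) : UnitAddCircle) = x i :=
  AddCircle.coe_equivIoc

theorem mFourier_neg_eq_wave (n : Fin d → ℤ) (x : UnitAddTorus (Fin d)) :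
    UnitAddTorus.mFourier (-n) x = wave (intVec n) (torusLift x) := by
  change ∏ i, fourier ((-n) i) (x i) = _
  have h : ∀ i, fourier ((-n) i) (x i)
      = Complex.exp (((-2 * Real.pi * (n i * torusLift x i) : ℝ) : ℂ) * Complex.I) := by
    intro i
    rw [← coe_torusLift x i, fourier_coe_apply]
    congr 1
    push_cast [Pi.neg_apply]
    ring
  rw [Finset.prod_congr rfl fun i _ => h i, ← Complex.exp_sum, wave, ← Finset.sum_mul,
    ← Complex.ofReal_sum, ← Finset.mul_sum, PiLp.inner_apply]
  congr 4
  refine Finset.sum_congr rfl fun i _ => ?_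
  simp [intVec, mul_comm]

theorem integral_torusLift (F : Euc d → ℂ) (hF : AEStronglyMeasurable F volume) :
    ∫ x : UnitAddTorus (Fin d), F (torusLift x) = ∫ s in cube d, F s := by
  have h := measurePreserving_torusLift (d := d)
  rw [← h.map_eq, integral_map h.measurable.aemeasurable]
  rw [h.map_eq]
  exact hF.restrict

theorem volume_cube_lt_top : volume (cube d) < ⊤ := by
  have h := (measurePreserving_torusLift (d := d)).measure_preimage
    (s := Set.univ) MeasurableSet.univ.nullMeasurableSet
  rw [Measure.restrict_apply_univ, Set.preimage_univ] at h
  rw [← h]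
  exact measure_lt_top _ _

/-- Parseval's identity for functions supported in the unit cube. -/
theorem hasSum_sq_integral_wave {F : Euc d → ℂ} (hF : MemLp F 2 volume)
    (hs : ∀ᵐ s, s ∉ cube d → F s = 0) :
    HasSum (fun n : Fin d → ℤ => ‖∫ s, wave (intVec n) s * F s‖ ^ 2) (∫ s, ‖F s‖ ^ 2) := by
  have hρ := measurePreserving_torusLift (d := d)
  have hf : MemLp (fun x => F (torusLift x)) 2 (volume : Measure (UnitAddTorus (Fin d))) :=
    (hF.restrict (cube d)).comp_measurePreserving hρ
  have h := UnitAddTorus.hasSum_sq_mFourierCoeff (hf.toLp _)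
  have hres : ∀ {E : Type} [NormedAddCommGroup E] [NormedSpace ℝ E] (G : Euc d → E),
      (∀ s, F s = 0 → G s = 0) → ∫ s in cube d, G s = ∫ s, G s := by
    intro E _ _ G hG
    refine setIntegral_eq_integral_of_ae_compl_eq_zero ?_
    filter_upwards [hs] with s h1 h2 using hG s (h1 h2)
  have hint : ∫ x, ‖hf.toLp _ x‖ ^ 2 = ∫ s, ‖F s‖ ^ 2 := by
    rw [← hres (fun s => ‖F s‖ ^ 2) (by intro s h; simp [h]), ← hρ.map_eq,
      integral_map hρ.measurable.aemeasurable]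
    · refine integral_congr_ae ?_
      filter_upwards [hf.coeFn_toLp] with x hx
      rw [hx]
    · rw [hρ.map_eq]
      exact (hF.1.norm.pow 2).restrict
  rw [hint] at h
  refine h.congr_fun fun n => ?_
  congr 2
  rw [← hres (fun s => wave (intVec n) s * F s) (by intro s h; simp [h]), ← integral_torusLift
    (fun s => wave (intVec n) s * F s) ((continuous_wave _).aestronglyMeasurable.mul hF.1), UnitAddTorus.mFourierCoeff]
  refine integral_congr_ae ?_
  filter_upwards [hf.coeFn_toLp] with x hx
  rw [hx, mFourier_neg_eq_wave, smul_eq_mul]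

theorem integral_cube_wave (n : Fin d → ℤ) :
    ∫ s in cube d, wave (intVec n) s = if n = 0 then 1 else 0 := by
  rw [← integral_torusLift _ (continuous_wave _).aestronglyMeasurable]
  have h0 := orthonormal_iff_ite.mp (UnitAddTorus.orthonormal_mFourier (d := Fin d)) n 0
  rw [← h0, ← UnitAddTorus.coe_mFourierBasis, ← HilbertBasis.repr_apply_apply,
    UnitAddTorus.mFourierBasis_repr, UnitAddTorus.coe_mFourierBasis,
    UnitAddTorus.mFourierCoeff_toLp, UnitAddTorus.mFourierCoeff]
  refine integral_congr_ae (Filter.Eventually.of_forall fun x => ?_)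
  simp only [mFourier_neg_eq_wave, UnitAddTorus.mFourier_zero]
  simp

/-- The indicator function of the unit cube. -/
def cubeIndicator (d : ℕ) : L2 d :=
  indicatorConstLp 2 measurableSet_cube volume_cube_lt_top.ne (1 : ℂ)

theorem coeFn_cubeIndicator :
    (cubeIndicator d : Euc d → ℂ) =ᵐ[volume] (cube d).indicator fun _ => 1 :=
  indicatorConstLp_coeFn

/-- By Plancherel, inner products of translates are Fourier coefficients of a product of spectra.
This serves both the start of the cascade and the analysis of functions of small spectrum. -/
theorem inner_translation_eq (v w : Euc d) (f g : L2 d) :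
    inner ℂ (translation v f) (translation w g)
      = ∫ s, (wave (w - v) s) * (inner ℂ (FT d f s) (FT d g s) : ℂ) := by
  rw [← (FT d).inner_map_map, FT_translation, FT_translation, L2.inner_def]
  refine integral_congr_ae ?_
  filter_upwards [coeFn_modulation v (FT d f), coeFn_modulation w (FT d g)] with s h1 h2
  rw [h1, h2, RCLike.inner_apply, RCLike.inner_apply, map_mul, conj_wave, sub_eq_add_neg,
    wave_add_left]
  ring

theorem orthonormal_translation_cubeIndicator :
    Orthonormal ℂ fun k : Fin d → ℤ => translation (intVec k) ((FT d).symm (cubeIndicator d)) := by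
  rw [orthonormal_iff_ite]
  intro k l
  rw [inner_translation_eq, LinearIsometryEquiv.apply_symm_apply]
  have h1 : ∀ᵐ s, wave (intVec l - intVec k) s *
      (inner ℂ (cubeIndicator d s) (cubeIndicator d s) : ℂ)
      = (cube d).indicator (fun s => wave (intVec (l - k)) s) s := by
    filter_upwards [coeFn_cubeIndicator (d := d)] with s hs
    rw [hs, sub_eq_add_neg l, intVec_add, intVec_neg, ← sub_eq_add_neg]
    by_cases h : s ∈ cube d <;> simp [h]
  rw [integral_congr_ae h1, integral_indicator measurableSet_cube, integral_cube_wave]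
  simp only [sub_eq_zero, eq_comm]

end FourierSeries

/-! ### The cascade algorithm -/

/-- The operator `x ↦ ∑_n h_n D_A T_n x`. -/
def refinement (A : Matrix (Fin d) (Fin d) ℤ) (N : ℕ) (h : (Fin d → ℤ) → ℂ) (x : L2 d) : L2 d :=
  ∑ n ∈ box d N, h n • dilation (toReal A) (translation (intVec n) x)

theorem coeFn_sum_smul {ι : Type*} (s : Finset ι) (c : ι → ℂ) (f : ι → L2 d) :
    (∑ i ∈ s, c i • f i : L2 d) =ᵐ[volume] fun t => ∑ i ∈ s, c i * f i t := by
  classical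
  induction s using Finset.induction_on with
  | empty =>
    filter_upwards [Lp.coeFn_zero ℂ 2 (volume : Measure (Euc d))] with t ht
    simp
  | insert i s hi ih =>
    rw [Finset.sum_insert hi]
    filter_upwards [Lp.coeFn_add (c i • f i) (∑ i ∈ s, c i • f i), ih,
      Lp.coeFn_smul (c i) (f i)] with t h1 h2 h3
    rw [h1, Pi.add_apply, h2, h3, Pi.smul_apply, smul_eq_mul, Finset.sum_insert hi]

theorem coeFn_FT_sum_translation {ι : Type*} (s : Finset ι) (c : ι → ℂ) (v : ι → Euc d) (x : L2 d) :
    FT d (∑ i ∈ s, c i • translation (v i) x) =ᵐ[volume]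
      fun t => (∑ i ∈ s, c i * wave (v i) t) * FT d x t := by
  have h0 : FT d (∑ i ∈ s, c i • translation (v i) x)
      = ∑ i ∈ s, c i • modulation (v i) (FT d x) := by
    rw [map_sum]
    exact Finset.sum_congr rfl fun i _ => by rw [map_smul, FT_translation]
  rw [h0]
  have h1 : ∀ᵐ t, ∀ i ∈ s, modulation (v i) (FT d x) t = wave (v i) t * FT d x t :=
    (Finset.eventually_all s).mpr fun i _ => coeFn_modulation (v i) (FT d x)
  filter_upwards [coeFn_sum_smul s c fun i => modulation (v i) (FT d x), h1] with t h2 h3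
  rw [h2, Finset.sum_mul]
  exact Finset.sum_congr rfl fun i hi => by rw [h3 i hi, mul_assoc]

section Lawton

variable {A : Matrix (Fin d) (Fin d) ℤ} {N : ℕ} {h : (Fin d → ℤ) → ℂ}

theorem det_toReal_ne_zero (hA : A.det.natAbs = 2) : (toReal A).det ≠ 0 := by
  rw [det_toReal]
  have : A.det ≠ 0 := by rintro h0; simp [h0] at hA
  exact_mod_cast this

theorem abs_det_toReal (hA : A.det.natAbs = 2) : |(toReal A).det| = 2 := by
  rw [det_toReal, ← Int.cast_abs, Int.abs_eq_natAbs, hA]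
  norm_num

theorem mulVec_injective (hA : A.det.natAbs = 2) : Function.Injective A.mulVec := by
  intro x y hxy
  have h0 : A.mulVec (x - y) = 0 := by rw [Matrix.mulVec_sub, hxy, sub_self]
  by_contra hne
  have := Matrix.exists_mulVec_eq_zero_iff.mp ⟨x - y, sub_ne_zero.mpr hne, h0⟩
  simp [this] at hA

theorem coeFn_FT_refine (hA : A.det.natAbs = 2) (x : L2 d) :
    FT d (refinement A N h x) =ᵐ[volume] fun s =>
      mask N h (act (toReal A).transpose⁻¹ s) * FT d x (act (toReal A).transpose⁻¹ s) := by
  have hA0 := det_toReal_ne_zero hA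
  have h0 : refinement A N h x
      = dilation (toReal A) (∑ n ∈ box d N, h n • translation (intVec n) x) := by
    rw [map_sum]
    exact Finset.sum_congr rfl fun i _ => by rw [map_smul]
  rw [h0, FT_dilation hA0]
  filter_upwards [coeFn_dilation (det_transpose_inv_ne_zero hA0)
      (FT d (∑ n ∈ box d N, h n • translation (intVec n) x)),
    act_ae_comp (det_transpose_inv_ne_zero hA0)
      (coeFn_FT_sum_translation (box d N) h intVec x)] with s h1 h2
  -- The factor `1/√2` of the mask is the factor `|det A|^(-1/2)` of the dual dilation.
  rw [h1, h2, mask, ← mul_assoc, Matrix.det_nonsing_inv, Matrix.det_transpose,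
    Ring.inverse_eq_inv', abs_inv, abs_det_toReal hA, Real.sqrt_inv, one_div]

theorem IsFiniteLawtonSolution.sum_mul_conj (hh : IsFiniteLawtonSolution A N h) {k : Fin d → ℤ}
    (hk : k ∈ lattice A) :
    ∑ n ∈ box d N, h n * (starRingEnd ℂ) (h (n + k)) = if k = 0 then 1 else 0 := by
  rw [← hh.orthogonality k hk]
  exact (finsum_eq_sum_of_support_subset _
    (hh.support_subset _ fun n hn => by rw [hn, zero_mul])).symm

theorem translation_intVec_dilation (hA : A.det.natAbs = 2) (k : Fin d → ℤ) (x : L2 d) :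
    translation (intVec k) (dilation (toReal A) x)
      = dilation (toReal A) (translation (intVec (A.mulVec k)) x) := by
  rw [translation_dilation (det_toReal_ne_zero hA), act_intVec]

theorem translation_sum_dilation (hA : A.det.natAbs = 2) (s : Finset (Fin d → ℤ))
    (c : (Fin d → ℤ) → ℂ) (k : Fin d → ℤ) (x : L2 d) :
    translation (intVec k) (∑ n ∈ s, c n • dilation (toReal A) (translation (intVec n) x))
      = ∑ n ∈ s, c n • dilation (toReal A) (translation (intVec (A.mulVec k + n)) x) := by
  rw [map_sum]
  refine Finset.sum_congr rfl fun n _ => ?_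
  rw [map_smul, translation_intVec_dilation hA, translation_add, ← intVec_add]

theorem translation_refine (hA : A.det.natAbs = 2) (k : Fin d → ℤ) (x : L2 d) :
    translation (intVec k) (refinement A N h x) = ∑ n ∈ box d N,
      h n • dilation (toReal A) (translation (intVec (A.mulVec k + n)) x) :=
  translation_sum_dilation hA _ _ _ _

/-- One step of the cascade algorithm preserves orthonormality of the integer translates. -/
theorem IsFiniteLawtonSolution.orthonormal_refine (hh : IsFiniteLawtonSolution A N h)
    (hA : A.det.natAbs = 2) {x : L2 d}
    (hx : Orthonormal ℂ fun k : Fin d → ℤ => translation (intVec k) x) :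
    Orthonormal ℂ fun k : Fin d → ℤ => translation (intVec k) (refinement A N h x) := by
  rw [orthonormal_iff_ite] at hx ⊢
  intro k l
  rw [translation_refine hA, translation_refine hA, sum_inner]
  -- By orthonormality of the old translates only `m = n + A (k - l)` contributes, which leaves an
  -- autocorrelation of `h` at a point of `A ℤ^d`: the left side of Lawton's equations.
  have h1 : ∀ n ∈ box d N, inner ℂ (h n • dilation (toReal A)
      (translation (intVec (A.mulVec k + n)) x)) (∑ n ∈ box d N,
        h n • dilation (toReal A) (translation (intVec (A.mulVec l + n)) x))
      = (starRingEnd ℂ) (h n * (starRingEnd ℂ) (h (n + A.mulVec (k - l)))) := by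
    intro n _
    rw [inner_sum]
    simp only [inner_smul_left, inner_smul_right, LinearIsometryEquiv.inner_map_map, hx]
    rw [Finset.sum_eq_single (n + A.mulVec (k - l))]
    · rw [if_pos, mul_one, map_mul, Complex.conj_conj, mul_comm]
      rw [Matrix.mulVec_sub]; abel
    · intro m _ hm
      rw [if_neg, mul_zero, mul_zero]
      intro h2
      apply hm
      rw [Matrix.mulVec_sub, ← add_right_inj (A.mulVec l), ← h2]
      abel
    · intro hm
      rw [hh.finite _ hm, zero_mul]
  rw [Finset.sum_congr rfl h1, ← map_sum, hh.sum_mul_conj ⟨k - l, rfl⟩]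
  have h2 : A.mulVec (k - l) = 0 ↔ k = l := by
    rw [← sub_eq_zero (a := k), ← (mulVec_injective hA).eq_iff (a := k - l), Matrix.mulVec_zero]
  simp only [h2]
  split_ifs <;> simp

/-- The cascade algorithm, started from the inverse Fourier transform of the unit cube. -/
def cascade (A : Matrix (Fin d) (Fin d) ℤ) (N : ℕ) (h : (Fin d → ℤ) → ℂ) : ℕ → L2 d
  | 0 => (FT d).symm (cubeIndicator d)
  | J + 1 => refinement A N h (cascade A N h J)

theorem IsFiniteLawtonSolution.orthonormal_cascade (hh : IsFiniteLawtonSolution A N h)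
    (hA : A.det.natAbs = 2) (J : ℕ) :
    Orthonormal ℂ fun k : Fin d → ℤ => translation (intVec k) (cascade A N h J) := by
  induction J with
  | zero => exact orthonormal_translation_cubeIndicator
  | succ J ih => exact hh.orthonormal_refine hA ih

/-- Each step inserts one mask factor and replaces `s` by `(Aᵀ)⁻¹ s` in the rest, so the partial
products appear with a cutoff to a growing dilate of the cube. -/
theorem coeFn_FT_cascade (hA : A.det.natAbs = 2) (J : ℕ) :
    FT d (cascade A N h J) =ᵐ[volume] fun s =>
      (∏ j ∈ Finset.range J, mask N h (act ((toReal A).transpose⁻¹ ^ (j + 1)) s)) *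
        (cube d).indicator (fun _ => 1) (act ((toReal A).transpose⁻¹ ^ J) s) := by
  induction J with
  | zero =>
    rw [cascade, LinearIsometryEquiv.apply_symm_apply]
    filter_upwards [coeFn_cubeIndicator (d := d)] with s hs
    rw [hs]
    simp [act_one]
  | succ J ih =>
    filter_upwards [coeFn_FT_refine (N := N) (h := h) hA (cascade A N h J),
      act_ae_comp (det_transpose_inv_ne_zero (det_toReal_ne_zero hA)) ih] with s h1 h2
    rw [cascade, h1, h2, Finset.prod_range_succ']
    simp only [act_mul, ← pow_succ, zero_add, pow_one]
    ring

theorem tendsto_act_pow {M : Matrix (Fin d) (Fin d) ℝ} (hM : IsContracting M) (s : Euc d) :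
    Filter.Tendsto (fun n : ℕ => act (M ^ n) s) Filter.atTop (nhds 0) := by
  obtain ⟨C, r, hC, hr, hr1, hb⟩ := hM
  rw [tendsto_zero_iff_norm_tendsto_zero]
  refine squeeze_zero (fun _ => norm_nonneg _) (fun n => hb n s) ?_
  have := ((tendsto_pow_atTop_nhds_zero_of_lt_one hr hr1).const_mul C).mul_const ‖s‖
  simpa using this

/-- The synthesis bound for the (not yet square integrable) limit of the cascade algorithm. -/
theorem IsFiniteLawtonSolution.eLpNorm_trig_mul_maskProd_le (hh : IsFiniteLawtonSolution A N h)
    (hA : A.det.natAbs = 2) (hc : IsContracting (toReal A).transpose⁻¹)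
    (F : Finset (Fin d → ℤ)) (c : (Fin d → ℤ) → ℂ) :
    eLpNorm (fun s => (∑ k ∈ F, c k * wave (intVec k) s) *
        maskProd (toReal A).transpose⁻¹ (mask N h) s) 2 volume
      ≤ ENNReal.ofReal (Real.sqrt (∑ k ∈ F, ‖c k‖ ^ 2)) := by
  obtain ⟨K, hK, hm⟩ := hh.exists_mask_bound
  let y : ℕ → L2 d := fun J => ∑ k ∈ F, c k • translation (intVec k) (cascade A N h J)
  -- The translates of each iterate are orthonormal, so these norms do not depend on `J`.
  have hy : ∀ J, eLpNorm (FT d (y J)) 2 volume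
      = ENNReal.ofReal (Real.sqrt (∑ k ∈ F, ‖c k‖ ^ 2)) := by
    intro J
    have h1 : ‖y J‖ = Real.sqrt (∑ k ∈ F, ‖c k‖ ^ 2) := by
      rw [@norm_eq_sqrt_re_inner ℂ, (hh.orthonormal_cascade hA J).inner_sum]
      congr 1
      rw [map_sum]
      refine Finset.sum_congr rfl fun k _ => ?_
      rw [mul_comm, Complex.mul_conj, Complex.normSq_eq_norm_sq]
      exact Complex.ofReal_re _
    rw [← h1, ← (FT d).norm_map, Lp.norm_def, ENNReal.ofReal_toReal (Lp.eLpNorm_ne_top _)]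
  -- Fatou's lemma: equality of norms along the sequence becomes an inequality in the pointwise
  -- limit.
  refine (Lp.eLpNorm_lim_le_liminf_eLpNorm (f := fun J => FT d (y J))
    (fun J => Lp.aestronglyMeasurable _) _ ?_).trans (le_of_eq ?_)
  · have h1 : ∀ᵐ s, ∀ J, FT d (y J) s = (∑ k ∈ F, c k * wave (intVec k) s) *
        ((∏ j ∈ Finset.range J, mask N h (act ((toReal A).transpose⁻¹ ^ (j + 1)) s)) *
        (cube d).indicator (fun _ => 1) (act ((toReal A).transpose⁻¹ ^ J) s)) := by
      rw [ae_all_iff]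
      intro J
      filter_upwards [coeFn_FT_sum_translation F c intVec (cascade A N h J),
        coeFn_FT_cascade (N := N) (h := h) hA J] with s h1 h2
      rw [h1, h2]
    filter_upwards [h1] with s hs
    simp only [hs]
    refine Filter.Tendsto.const_mul _ ?_
    -- The point `(Aᵀ)^(-J) s` eventually lies in the cube, and from then on the cutoff equals `1`.
    have h2 : Filter.Tendsto (fun J => (cube d).indicator (fun _ => (1 : ℂ))
        (act ((toReal A).transpose⁻¹ ^ J) s)) Filter.atTop (nhds 1) := by
      refine tendsto_const_nhds.congr' ?_
      filter_upwards [(tendsto_act_pow hc s).eventually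
        (Metric.ball_mem_nhds (0 : Euc d) (half_pos one_pos))] with J hJ
      rw [Set.indicator_of_mem (ball_subset_cube hJ)]
    have h3 := (tendsto_maskProd hc hK hm s).mul h2
    rwa [mul_one] at h3
  · simp only [hy]
    exact Filter.liminf_const _

theorem IsFiniteLawtonSolution.memLp_maskProd (hh : IsFiniteLawtonSolution A N h)
    (hA : A.det.natAbs = 2) (hc : IsContracting (toReal A).transpose⁻¹) :
    MemLp (maskProd (toReal A).transpose⁻¹ (mask N h)) 2 volume := by
  obtain ⟨K, hK, hm⟩ := hh.exists_mask_bound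
  refine ⟨aestronglyMeasurable_maskProd hc hK hm (continuous_mask N h), ?_⟩
  have h1 := hh.eLpNorm_trig_mul_maskProd_le hA hc {0} (fun _ => 1)
  simp only [Finset.sum_singleton, intVec_zero, wave_zero_left, one_mul] at h1
  exact h1.trans_lt ENNReal.ofReal_lt_top

/-! ### The scaling function -/

/-- The properties of the scaling function on which the construction rests. -/
structure IsScaling (A : Matrix (Fin d) (Fin d) ℤ) (N : ℕ) (h : (Fin d → ℤ) → ℂ) (φ : L2 d) :
    Prop where
  coeFn_FT : FT d φ =ᵐ[volume] maskProd (toReal A).transpose⁻¹ (mask N h)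
  refine_eq : φ = refinement A N h φ
  bessel : ∀ (f : L2 d) (F : Finset (Fin d → ℤ)),
    ∑ k ∈ F, ‖(inner ℂ (translation (intVec k) φ) f : ℂ)‖ ^ 2 ≤ ‖f‖ ^ 2

theorem IsFiniteLawtonSolution.isScaling (hh : IsFiniteLawtonSolution A N h)
    (hA : A.det.natAbs = 2) (hc : IsContracting (toReal A).transpose⁻¹) {φ : L2 d}
    (hφ : FT d φ =ᵐ[volume] maskProd (toReal A).transpose⁻¹ (mask N h)) : IsScaling A N h φ := by
  obtain ⟨K, hK, hm⟩ := hh.exists_mask_bound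
  refine ⟨hφ, ?_, fun f F => ?_⟩
  · apply (FT d).injective
    apply Lp.ext
    filter_upwards [coeFn_FT_refine (N := N) (h := h) hA φ, hφ,
      act_ae_comp (det_transpose_inv_ne_zero (det_toReal_ne_zero hA)) hφ] with s h1 h2 h3
    rw [h1, h2, h3, maskProd_eq_mul hc hK hm]
  -- Duality: for `y = ∑ c_k T_k φ` with `c_k = ⟨T_k φ, f⟩` one has `⟨y, f⟩ = S` and `‖y‖ ≤ √S`, so
  -- Cauchy–Schwarz gives `S ≤ √S ‖f‖`.
  · set c : (Fin d → ℤ) → ℂ := fun k => inner ℂ (translation (intVec k) φ) f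
    set S := ∑ k ∈ F, ‖c k‖ ^ 2
    have hS : 0 ≤ S := Finset.sum_nonneg fun _ _ => by positivity
    let y : L2 d := ∑ k ∈ F, c k • translation (intVec k) φ
    have hy : ‖y‖ ≤ Real.sqrt S := by
      rw [← (FT d).norm_map, Lp.norm_def]
      refine ENNReal.toReal_le_of_le_ofReal (Real.sqrt_nonneg _) ?_
      refine le_trans (le_of_eq (eLpNorm_congr_ae ?_)) (hh.eLpNorm_trig_mul_maskProd_le hA hc F c)
      filter_upwards [coeFn_FT_sum_translation F c intVec φ, hφ] with s h1 h2
      rw [h1, h2]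
    have hin : (inner ℂ y f : ℂ) = (S : ℂ) := by
      rw [sum_inner, Complex.ofReal_sum]
      refine Finset.sum_congr rfl fun k _ => ?_
      rw [inner_smul_left, mul_comm, Complex.mul_conj, Complex.normSq_eq_norm_sq]
    have h1 : S ≤ Real.sqrt S * ‖f‖ := by
      have h2 := norm_inner_le_norm (𝕜 := ℂ) y f
      rw [hin, Complex.norm_real, Real.norm_of_nonneg hS] at h2
      exact h2.trans (mul_le_mul_of_nonneg_right hy (norm_nonneg f))
    rcases hS.eq_or_lt with h0 | h0
    · rw [← h0]; positivity
    · have h2 : Real.sqrt S ≤ ‖f‖ := by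
        have h3 := Real.sqrt_pos.mpr h0
        nlinarith [Real.mul_self_sqrt hS]
      calc S = Real.sqrt S ^ 2 := (Real.sq_sqrt hS).symm
        _ ≤ ‖f‖ ^ 2 := by gcongr

theorem IsFiniteLawtonSolution.memLp_scalingFourier (hh : IsFiniteLawtonSolution A N h)
    (hA : A.det.natAbs = 2) (hc : IsContracting (toReal A).transpose⁻¹) :
    MemLp (scalingFourier A h) 2 (volume : Measure (Euc d)) := by
  rw [hh.scalingFourier_eq]
  exact memLp_dilateFun det_scaleMatrix_ne_zero (hh.memLp_maskProd hA hc)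

theorem IsFiniteLawtonSolution.coeFn_FT_scaling (hh : IsFiniteLawtonSolution A N h)
    (hA : A.det.natAbs = 2) (hc : IsContracting (toReal A).transpose⁻¹)
    (hg : MemLp (scalingFourier A h) 2 (volume : Measure (Euc d))) :
    FT d (scaling A h hg) =ᵐ[volume] maskProd (toReal A).transpose⁻¹ (mask N h) := by
  have hG := hh.memLp_maskProd hA hc
  have h1 : dilation ((2 * Real.pi)⁻¹ • (1 : Matrix (Fin d) (Fin d) ℝ)) (hG.toLp _)
      = hg.toLp (scalingFourier A h) := by
    apply Lp.ext
    filter_upwards [coeFn_dilation (det_scaleMatrix_ne_zero (d := d)) (hG.toLp _),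
      dilateFun_congr det_scaleMatrix_ne_zero hG.coeFn_toLp, hg.coeFn_toLp] with s h1 h2 h3
    rw [h1, h3, hh.scalingFourier_eq, ← h2]
    rfl
  have h2 : FT d (scaling A h hg) = hG.toLp _ := by
    rw [scaling, ← h1]
    change FT d ((FT d).symm ((dilation _).symm (dilation _ (hG.toLp _)))) = _
    rw [LinearIsometryEquiv.symm_apply_apply, LinearIsometryEquiv.apply_symm_apply]
  rw [h2]
  exact hG.coeFn_toLp

end Lawton

/-! ### The analysis operator -/

theorem ofReal_norm_sq_eq_lintegral (f : L2 d) :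
    ENNReal.ofReal (‖f‖ ^ 2) = ∫⁻ s, ‖f s‖ₑ ^ 2 := by
  have h := eLpNorm_nnreal_pow_eq_lintegral (f := (f : Euc d → ℂ)) (μ := volume) (p := 2) two_ne_zero
  have h2 : ∀ x : ENNReal, x ^ ((2 : NNReal) : ℝ) = x ^ 2 := fun x => by
    rw [NNReal.coe_ofNat, ENNReal.rpow_ofNat]
  simp only [h2] at h
  rw [← h, ENNReal.ofReal_pow (norm_nonneg f), Lp.norm_def,
    ENNReal.ofReal_toReal (Lp.eLpNorm_ne_top f)]
  rfl

theorem norm_sq_eq_integral (f : L2 d) : ‖f‖ ^ 2 = ∫ s, ‖f s‖ ^ 2 := by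
  have h1 : (inner ℂ f f : ℂ) = ((∫ s, ‖f s‖ ^ 2 : ℝ) : ℂ) := by
    rw [L2.inner_def, ← integral_complex_ofReal]
    refine integral_congr_ae (Filter.Eventually.of_forall fun s => ?_)
    simp only
    rw [inner_self_eq_norm_sq_to_K]
    push_cast
    rfl
  rw [@norm_sq_eq_re_inner ℂ, h1]
  exact Complex.ofReal_re _

/-- The integer translates of `φ` form a Bessel sequence with bound `1`. -/
def IsBessel (φ : L2 d) : Prop := ∀ (f : L2 d) (F : Finset (Fin d → ℤ)),
  ∑ k ∈ F, ‖(inner ℂ (translation (intVec k) φ) f : ℂ)‖ ^ 2 ≤ ‖f‖ ^ 2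

/-- The operator `f ↦ (⟨T_k φ, f⟩)_k` into `ℓ²(ℤ^d)`. -/
def analysis {φ : L2 d} (hφ : IsBessel φ) : L2 d →ₗ[ℂ] lp (fun _ : Fin d → ℤ => ℂ) 2 where
  toFun f := ⟨fun k => inner ℂ (translation (intVec k) φ) f,
    memℓp_gen' (C := ‖f‖ ^ 2) fun F => by simpa using hφ f F⟩
  map_add' f g := by ext k; exact inner_add_right _ _ _
  map_smul' c f := by ext k; exact inner_smul_right _ _ _

section Analysis

variable {φ : L2 d} (hφ : IsBessel φ)

theorem analysis_apply (f : L2 d) (k : Fin d → ℤ) :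
    analysis hφ f k = inner ℂ (translation (intVec k) φ) f := rfl

theorem norm_analysis_le_of_sum_le {f : L2 d} {C : ℝ} (hC : 0 ≤ C)
    (h : ∀ F : Finset (Fin d → ℤ),
      ∑ k ∈ F, ‖(inner ℂ (translation (intVec k) φ) f : ℂ)‖ ^ 2 ≤ C ^ 2) :
    ‖analysis hφ f‖ ≤ C :=
  lp.norm_le_of_forall_sum_le (by simp) hC fun F => by simpa [analysis_apply] using h F

theorem norm_analysis_le (f : L2 d) : ‖analysis hφ f‖ ≤ ‖f‖ :=
  norm_analysis_le_of_sum_le hφ (norm_nonneg f) (hφ f)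

theorem hasSum_sq_analysis (f : L2 d) :
    HasSum (fun k => ‖(inner ℂ (translation (intVec k) φ) f : ℂ)‖ ^ 2) (‖analysis hφ f‖ ^ 2) := by
  have := lp.hasSum_norm (p := 2) (by simp) (analysis hφ f)
  simpa [analysis_apply] using this

/-- Norm limits of contractions may be checked on a dense set. -/
theorem tendsto_norm_analysis_of_dense (u : ℕ → L2 d ≃ₗᵢ[ℂ] L2 d) {c : ℝ} (hc0 : 0 ≤ c)
    (hc1 : c ≤ 1) (h : ∀ (f : L2 d) (ε : ℝ), 0 < ε → ∃ g : L2 d, ‖f - g‖ ≤ ε ∧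
      Filter.Tendsto (fun n => ‖analysis hφ (u n g)‖) Filter.atTop (nhds (c * ‖g‖))) (f : L2 d) :
    Filter.Tendsto (fun n => ‖analysis hφ (u n f)‖) Filter.atTop (nhds (c * ‖f‖)) := by
  rw [Metric.tendsto_atTop]
  intro ε hε
  obtain ⟨g, hg, hlim⟩ := h f (ε / 3) (by positivity)
  obtain ⟨n₀, hn₀⟩ := Metric.tendsto_atTop.mp hlim (ε / 3) (by positivity)
  refine ⟨n₀, fun n hn => ?_⟩
  have h1 := hn₀ n hn
  rw [Real.dist_eq, abs_lt] at h1 ⊢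
  have h2 : |‖analysis hφ (u n f)‖ - ‖analysis hφ (u n g)‖| ≤ ε / 3 := by
    refine (abs_norm_sub_norm_le _ _).trans ?_
    rw [← map_sub, ← map_sub]
    exact (norm_analysis_le hφ _).trans (by rwa [(u n).norm_map])
  have h3 : |c * ‖f‖ - c * ‖g‖| ≤ ε / 3 := by
    rw [← mul_sub, abs_mul, abs_of_nonneg hc0]
    calc c * |‖f‖ - ‖g‖| ≤ 1 * |‖f‖ - ‖g‖| := by gcongr
      _ ≤ ε / 3 := by rw [one_mul]; exact (abs_norm_sub_norm_le _ _).trans hg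
  rw [abs_le] at h2 h3
  constructor <;> linarith [h1.1, h1.2, h2.1, h2.2, h3.1, h3.2]

end Analysis

/-- Functions of bounded support are dense. -/
theorem exists_bounded_support (f : L2 d) {ε : ℝ} (hε : 0 < ε) :
    ∃ (g : L2 d) (R : ℝ), 0 < R ∧ ‖f - g‖ ≤ ε ∧ ∀ᵐ t, R ≤ ‖t‖ → g t = 0 := by
  obtain ⟨g, hgs, hfg, -, hgm⟩ := (Lp.memLp f).exists_hasCompactSupport_eLpNorm_sub_le
    (ENNReal.ofNat_ne_top) (ε := ENNReal.ofReal ε) (by simpa using hε)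
  obtain ⟨R, hR, hb⟩ := hgs.isCompact.isBounded.exists_pos_norm_lt
  refine ⟨hgm.toLp g, R, hR, ?_, ?_⟩
  · rw [Lp.norm_def]
    refine ENNReal.toReal_le_of_le_ofReal hε.le (le_trans (le_of_eq (eLpNorm_congr_ae ?_)) hfg)
    filter_upwards [Lp.coeFn_sub f (hgm.toLp g), hgm.coeFn_toLp] with t h1 h2
    rw [h1, Pi.sub_apply, Pi.sub_apply, h2]
  · filter_upwards [hgm.coeFn_toLp] with t h1 h2
    rw [h1]
    by_contra hne
    exact absurd (hb t (subset_tsupport g hne)) (not_lt.mpr h2)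

theorem exists_bounded_spectrum (f : L2 d) {ε : ℝ} (hε : 0 < ε) :
    ∃ (g : L2 d) (R : ℝ), 0 < R ∧ ‖f - g‖ ≤ ε ∧ ∀ᵐ t, R ≤ ‖t‖ → FT d g t = 0 := by
  obtain ⟨g, R, hR, h1, h2⟩ := exists_bounded_support (FT d f) hε
  refine ⟨(FT d).symm g, R, hR, ?_, by rwa [LinearIsometryEquiv.apply_symm_apply]⟩
  rwa [← (FT d).norm_map, map_sub, LinearIsometryEquiv.apply_symm_apply]

/-- A dilation by a matrix whose inverse is small shrinks bounded supports. -/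
theorem dilation_support {M : Matrix (Fin d) (Fin d) ℝ} (hM : M.det ≠ 0) {c R δ : ℝ} (hc : 0 ≤ c)
    (hb : ∀ t, ‖act M⁻¹ t‖ ≤ c * ‖t‖) (hδ : c * R < δ) {f : L2 d}
    (hf : ∀ᵐ t, R ≤ ‖t‖ → f t = 0) : ∀ᵐ t, δ ≤ ‖t‖ → dilation M f t = 0 := by
  filter_upwards [coeFn_dilation hM f, act_ae_comp hM hf] with t h1 h2 h3
  rw [h1, h2, mul_zero]
  by_contra hlt
  push Not at hlt
  have h4 := hb (act M t)
  rw [act_mul, Matrix.nonsing_inv_mul _ (isUnit_iff_ne_zero.mpr hM), act_one] at h4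
  have := mul_le_mul_of_nonneg_left hlt.le hc
  linarith

theorem IsContracting.eventually_lt {M : Matrix (Fin d) (Fin d) ℝ} (hM : IsContracting M) (R : ℝ)
    {δ : ℝ} (hδ : 0 < δ) : ∀ᶠ n : ℕ in Filter.atTop, ∃ c, 0 ≤ c ∧ c * R < δ ∧
      ∀ t, ‖act (M ^ n) t‖ ≤ c * ‖t‖ := by
  obtain ⟨C, r, hC, hr, hr1, hb⟩ := hM
  have h1 : Filter.Tendsto (fun n : ℕ => C * r ^ n * R) Filter.atTop (nhds 0) := by
    have := ((tendsto_pow_atTop_nhds_zero_of_lt_one hr hr1).const_mul C).mul_const R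
    simpa using this
  filter_upwards [h1.eventually_lt_const hδ] with n hn
  exact ⟨C * r ^ n, by positivity, hn, hb n⟩

/-! ### High resolution -/

section HighResolution

variable {φ : L2 d} (hφ : IsBessel φ) {G : Euc d → ℂ}

/-- On functions of small spectrum the analysis operator multiplies the spectrum by `conj G`. -/
theorem norm_le_mul_norm_analysis (hG : FT d φ =ᵐ[volume] G) {δ c : ℝ} (hδ : δ ≤ 1 / 2)
    (hGδ : ∀ s, ‖s‖ < δ → 1 ≤ c * ‖G s‖ ∧ ‖G s‖ ≤ 2) {x : L2 d}
    (hx : ∀ᵐ s, δ ≤ ‖s‖ → FT d x s = 0) : ‖x‖ ≤ c * ‖analysis hφ x‖ := by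
  let H : Euc d → ℂ := fun s => inner ℂ (FT d φ s) (FT d x s)
  have hHn : ∀ᵐ s, ‖H s‖ = ‖G s‖ * ‖FT d x s‖ := by
    filter_upwards [hG] with s hs
    simp only [H, RCLike.inner_apply, norm_mul, RCLike.norm_conj, hs]
    ring
  have hb : ∀ᵐ s, ‖H s‖ ≤ 2 * ‖FT d x s‖ ∧ ‖FT d x s‖ ≤ c * ‖H s‖ := by
    filter_upwards [hHn, hx] with s h1 h2
    rw [h1]
    by_cases hs : ‖s‖ < δ
    · obtain ⟨h3, h4⟩ := hGδ s hs
      have h5 := norm_nonneg (FT d x s)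
      refine ⟨by gcongr, ?_⟩
      rw [← mul_assoc]
      exact le_mul_of_one_le_left h5 h3
    · rw [h2 (not_lt.mp hs)]; simp
  have hHm : MemLp H 2 volume := by
    refine MemLp.of_le_mul (c := 2) (Lp.memLp (FT d x)) ?_ (hb.mono fun s hs => hs.1)
    exact (Lp.aestronglyMeasurable _).inner (Lp.aestronglyMeasurable _)
  -- The spectrum of `x` fits in the cube, so the coefficients `⟨T_k φ, x⟩` are all the Fourier
  -- coefficients of `H`, and Parseval applies without aliasing.
  have hsupp : ∀ᵐ s, s ∉ cube d → H s = 0 := by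
    filter_upwards [hx] with s h1 h2
    simp only [H]
    rw [h1, inner_zero_right]
    by_contra hlt
    exact h2 (ball_subset_cube (mem_ball_zero_iff.mpr ((not_le.mp hlt).trans_le hδ)))
  have hsum := hasSum_sq_integral_wave hHm hsupp
  rw [← (Equiv.neg (Fin d → ℤ)).hasSum_iff] at hsum
  have hsum' := hasSum_sq_analysis hφ x
  have hkey : ∀ k : Fin d → ℤ, (inner ℂ (translation (intVec k) φ) x : ℂ)
      = ∫ s, wave (intVec (-k)) s * H s := by
    intro k
    have h1 := inner_translation_eq (intVec k) 0 φ x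
    rwa [translation_zero, zero_sub, ← intVec_neg] at h1
  have heq : ‖analysis hφ x‖ ^ 2 = ∫ s, ‖H s‖ ^ 2 := by
    refine hsum'.unique (hsum.congr_fun fun k => ?_)
    rw [hkey]
    rfl
  have hnorm : ‖analysis hφ x‖ = ‖hHm.toLp H‖ := by
    refine (sq_eq_sq₀ (norm_nonneg _) (norm_nonneg _)).mp ?_
    rw [heq, norm_sq_eq_integral]
    refine integral_congr_ae ?_
    filter_upwards [hHm.coeFn_toLp] with s hs
    rw [hs]
  rw [hnorm, ← (FT d).norm_map]
  refine Lp.norm_le_mul_norm_of_ae_le_mul ?_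
  filter_upwards [hb, hHm.coeFn_toLp] with s h1 h2
  rw [h2]
  exact h1.2

/-- The operator `D⁻ⁿ` moves a bounded spectrum by `(Mᵀ)⁻ⁿ` into any neighbourhood of the origin,
where `|G|` is close to `1` and the analysis operator is nearly isometric. -/
theorem tendsto_norm_analysis_dilation_inv (hG : FT d φ =ᵐ[volume] G)
    (hG0 : Filter.Tendsto G (nhds 0) (nhds 1)) {M : Matrix (Fin d) (Fin d) ℝ} (hM : M.det ≠ 0)
    (hc : IsContracting M.transpose⁻¹) (f : L2 d) :
    Filter.Tendsto (fun n : ℕ => ‖analysis hφ (((dilation M)⁻¹ ^ n) f)‖) Filter.atTop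
      (nhds ‖f‖) := by
  have main := tendsto_norm_analysis_of_dense hφ (fun n => (dilation M)⁻¹ ^ n) zero_le_one le_rfl ?_ f
  · simpa using main
  intro f ε hε
  obtain ⟨g, R, hR, hfg, hg⟩ := exists_bounded_spectrum f hε
  refine ⟨g, hfg, ?_⟩
  rw [one_mul, Metric.tendsto_atTop]
  intro η hη
  -- Chosen so that `(c - 1) ‖g‖ < η`; the summand `1` in the denominator covers `g = 0`.
  set c : ℝ := 1 + η / (‖g‖ + 1) with hcdef
  have hgn := norm_nonneg g
  have hc1 : 1 < c := by
    rw [hcdef]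
    have : 0 < η / (‖g‖ + 1) := by positivity
    linarith
  have hcpos : 0 < c := one_pos.trans hc1
  have hcη : (c - 1) * ‖g‖ < η := by
    rw [hcdef, add_sub_cancel_left, div_mul_eq_mul_div, div_lt_iff₀ (by positivity)]
    nlinarith
  have hnear : ∀ᶠ s in nhds (0 : Euc d), 1 ≤ c * ‖G s‖ ∧ ‖G s‖ ≤ 2 := by
    have h1 := hG0.norm
    rw [norm_one] at h1
    filter_upwards [h1.eventually_const_lt (inv_lt_one_of_one_lt₀ hc1),
      h1.eventually_lt_const one_lt_two] with s h2 h3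
    refine ⟨?_, h3.le⟩
    calc 1 = c * c⁻¹ := (mul_inv_cancel₀ hcpos.ne').symm
      _ ≤ c * ‖G s‖ := by gcongr
  obtain ⟨δ₀, hδ₀, hball⟩ := Metric.eventually_nhds_iff_ball.mp hnear
  set δ := min δ₀ (1 / 2)
  have hδ : 0 < δ := lt_min hδ₀ (by norm_num)
  obtain ⟨n₀, hn₀⟩ := Filter.eventually_atTop.mp (hc.eventually_lt R hδ)
  refine ⟨n₀, fun n hn => ?_⟩
  obtain ⟨a, ha, haR, hab⟩ := hn₀ n hn
  have hMinv : M⁻¹.det ≠ 0 := det_inv_ne_zero hM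
  have hMn : (M⁻¹ ^ n).det ≠ 0 := by rw [Matrix.det_pow]; exact pow_ne_zero _ hMinv
  have hx : ((dilation M)⁻¹ ^ n) g = dilation (M⁻¹ ^ n) g := by
    rw [dilation_inv hM, dilation_pow hMinv]
  have hinv : (M⁻¹ ^ n).transpose⁻¹⁻¹ = M.transpose⁻¹ ^ n := by
    rw [Matrix.nonsing_inv_nonsing_inv _ (by
      rw [Matrix.det_transpose]; exact isUnit_iff_ne_zero.mpr hMn), Matrix.transpose_pow,
      Matrix.transpose_nonsing_inv]
  have hsupp : ∀ᵐ s, δ ≤ ‖s‖ → FT d (((dilation M)⁻¹ ^ n) g) s = 0 := by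
    rw [hx, FT_dilation hMn]
    exact dilation_support (det_transpose_inv_ne_zero hMn) ha (by rwa [hinv]) haR hg
  have h1 := norm_le_mul_norm_analysis hφ hG (min_le_right δ₀ (1 / 2))
    (fun s hs => hball s (mem_ball_zero_iff.mpr (hs.trans_le (min_le_left _ _)))) hsupp
  have h2 := norm_analysis_le hφ (((dilation M)⁻¹ ^ n) g)
  rw [LinearIsometryEquiv.norm_map] at h1 h2
  rw [Real.dist_eq, abs_lt]
  constructor <;> nlinarith

end HighResolution

/-! ### Low resolution -/

theorem one_le_norm_intVec {n : Fin d → ℤ} (hn : n ≠ 0) : 1 ≤ ‖intVec n‖ := by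
  obtain ⟨i, hi⟩ := Function.ne_iff.mp hn
  have h1 := PiLp.norm_apply_le (intVec n) i
  have h2 : (1 : ℝ) ≤ |(n i : ℝ)| := by
    rw [← Int.cast_abs]
    exact_mod_cast Int.one_le_abs hi
  exact h2.trans h1

theorem pairwise_disjoint_ball :
    Pairwise (Function.onFun Disjoint fun k : Fin d → ℤ => Metric.ball (-intVec k) (1 / 2 : ℝ)) := by
  intro k l hkl
  refine Metric.ball_disjoint_ball ?_
  rw [dist_eq_norm, ← intVec_neg, ← intVec_neg, sub_eq_add_neg, ← intVec_neg, ← intVec_add]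
  have := one_le_norm_intVec (n := -k + - -l) (by
    intro h
    apply hkl
    rw [neg_neg, neg_add_eq_zero] at h
    exact h)
  linarith

theorem measurable_enorm_sq (φ : L2 d) : Measurable fun t => ‖φ t‖ₑ ^ 2 :=
  ((Lp.stronglyMeasurable φ).measurable.enorm).pow_const 2

/-- The periodization of `|φ|²` is integrable near the origin. -/
theorem lintegral_periodization_ne_top (φ : L2 d) :
    ∫⁻ t in Metric.ball 0 (1 / 2), ∑' k : Fin d → ℤ, ‖φ (t - intVec k)‖ₑ ^ 2 ≠ ⊤ := by
  have hmp : ∀ k : Fin d → ℤ, MeasurePreserving (fun t : Euc d => t - intVec k) volume volume :=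
    fun k => measurePreserving_sub_right volume (intVec k)
  have hmeas : ∀ k : Fin d → ℤ, Measurable fun t => ‖φ (t - intVec k)‖ₑ ^ 2 :=
    fun k => (measurable_enorm_sq φ).comp (hmp k).measurable
  rw [lintegral_tsum fun k => (hmeas k).aemeasurable]
  have h1 : ∀ k : Fin d → ℤ, ∫⁻ t in Metric.ball 0 (1 / 2), ‖φ (t - intVec k)‖ₑ ^ 2
      = ∫⁻ t in Metric.ball (-intVec k) (1 / 2), ‖φ t‖ₑ ^ 2 := by
    intro k
    rw [← (hmp k).setLIntegral_comp_preimage measurableSet_ball (measurable_enorm_sq φ)]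
    congr 2
    ext t
    simp [dist_eq_norm]
  simp only [h1]
  -- Balls of radius `1/2` about distinct lattice points are disjoint, so the pieces add up to at
  -- most `‖φ‖²`.
  rw [← lintegral_iUnion (fun _ => measurableSet_ball) pairwise_disjoint_ball]
  refine ne_top_of_le_ne_top ?_ (setLIntegral_le_lintegral _ _)
  rw [← ofReal_norm_sq_eq_lintegral]
  exact ENNReal.ofReal_ne_top

/-- Absolute continuity of the integral; small balls have small volume because the dimension is
positive. -/
theorem exists_ball_lintegral_lt (hd : 0 < d) {Φ : Euc d → ENNReal}
    (hΦ : ∫⁻ t in Metric.ball 0 (1 / 2), Φ t ≠ ⊤) {ε : ENNReal} (hε : ε ≠ 0) :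
    ∃ δ : ℝ, 0 < δ ∧ ∫⁻ t in Metric.ball 0 δ, Φ t < ε := by
  have : Nonempty (Fin d) := ⟨⟨0, hd⟩⟩
  obtain ⟨η, hη, h⟩ := exists_pos_setLIntegral_lt_of_measure_lt hΦ hε
  have hlim : Filter.Tendsto (fun r : ℝ => volume (Metric.closedBall (0 : Euc d) r))
      (nhdsWithin 0 (Set.Ioi 0)) (nhds 0) := by
    have h0 : volume (Metric.ball (0 : Euc d) 1) ≠ ⊤ := measure_ball_lt_top.ne
    have h1 : Filter.Tendsto (fun r : ℝ => ENNReal.ofReal (r ^ Module.finrank ℝ (Euc d)) *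
        volume (Metric.ball (0 : Euc d) 1)) (nhdsWithin 0 (Set.Ioi 0)) (nhds 0) := by
      have h2 : Filter.Tendsto (fun r : ℝ => r ^ Module.finrank ℝ (Euc d))
          (nhdsWithin 0 (Set.Ioi 0)) (nhds 0) := by
        have h3 : Filter.Tendsto (fun r : ℝ => r ^ Module.finrank ℝ (Euc d)) (nhds 0) (nhds 0) := by
          have := (continuous_pow (M := ℝ) (Module.finrank ℝ (Euc d))).tendsto 0
          rwa [zero_pow (by rw [finrank_euclideanSpace, Fintype.card_fin]; exact hd.ne')] at this
        exact h3.mono_left nhdsWithin_le_nhds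
      have h4 := ENNReal.Tendsto.mul_const (ENNReal.tendsto_ofReal h2) (Or.inr h0)
      simpa using h4
    refine h1.congr' ?_
    filter_upwards [self_mem_nhdsWithin] with r hr
    rw [Measure.addHaar_closedBall _ _ (le_of_lt hr)]
  have hhalf : ∀ᶠ r : ℝ in nhdsWithin 0 (Set.Ioi 0), r < 1 / 2 :=
    mem_nhdsWithin_of_mem_nhds (Iio_mem_nhds (by norm_num))
  have hpos : ∀ᶠ r : ℝ in nhdsWithin 0 (Set.Ioi 0), 0 < r := self_mem_nhdsWithin
  obtain ⟨δ, h1, h2, h3⟩ := ((hlim.eventually_lt_const hη).and (hpos.and hhalf)).exists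
  refine ⟨δ, h2, ?_⟩
  have h4 := h (Metric.ball 0 δ) (lt_of_le_of_lt ((Measure.restrict_apply_le _ _).trans
    (measure_mono Metric.ball_subset_closedBall)) h1)
  rwa [Measure.restrict_restrict measurableSet_ball,
    Set.inter_eq_self_of_subset_left (Metric.ball_subset_ball (le_of_lt h3))] at h4

section LowResolution

variable {φ : L2 d} (hφ : IsBessel φ)

/-- The analysis operator is small on functions supported near the origin. -/
theorem exists_norm_analysis_le (hd : 0 < d) {ε : ℝ} (hε : 0 < ε) :
    ∃ δ : ℝ, 0 < δ ∧ ∀ x : L2 d, (∀ᵐ t, δ ≤ ‖t‖ → x t = 0) → ‖analysis hφ x‖ ≤ ε * ‖x‖ := by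
  obtain ⟨δ, hδ, hlt⟩ := exists_ball_lintegral_lt hd (lintegral_periodization_ne_top φ)
    (ε := ENNReal.ofReal (ε ^ 2)) (by simpa using hε.ne')
  refine ⟨δ, hδ, fun x hx => norm_analysis_le_of_sum_le hφ (by positivity) fun F => ?_⟩
  -- Only the part of `T_k φ` on the small ball meets `x`. Cauchy–Schwarz with these truncations
  -- bounds the energy by `‖x‖²` times the integral of the periodization of `|φ|²` over that ball.
  have hmem : ∀ k : Fin d → ℤ, MemLp ((Metric.ball 0 δ).indicator (translation (intVec k) φ)) 2
      volume := fun k => (Lp.memLp _).indicator measurableSet_ball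
  let y : (Fin d → ℤ) → L2 d := fun k => (hmem k).toLp _
  have hin : ∀ k, (inner ℂ (translation (intVec k) φ) x : ℂ) = inner ℂ (y k) x := by
    intro k
    rw [L2.inner_def, L2.inner_def]
    refine integral_congr_ae ?_
    filter_upwards [hx, (hmem k).coeFn_toLp] with t h1 h2
    rw [h2]
    by_cases ht : t ∈ Metric.ball (0 : Euc d) δ
    · rw [Set.indicator_of_mem ht]
    · rw [mem_ball_zero_iff, not_lt] at ht
      rw [h1 ht, inner_zero_right, inner_zero_right]
  have hy : ∀ k, ENNReal.ofReal (‖y k‖ ^ 2)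
      = ∫⁻ t in Metric.ball 0 δ, ‖φ (t - intVec k)‖ₑ ^ 2 := by
    intro k
    rw [ofReal_norm_sq_eq_lintegral, ← lintegral_indicator measurableSet_ball]
    refine lintegral_congr_ae ?_
    filter_upwards [(hmem k).coeFn_toLp, coeFn_translation (intVec k) φ] with t h1 h2
    rw [h1]
    by_cases ht : t ∈ Metric.ball (0 : Euc d) δ
    · rw [Set.indicator_of_mem ht, Set.indicator_of_mem ht, h2]
    · rw [Set.indicator_of_notMem ht, Set.indicator_of_notMem ht]; simp
  have hsum : ∑ k ∈ F, ‖y k‖ ^ 2 ≤ ε ^ 2 := by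
    rw [← ENNReal.ofReal_le_ofReal_iff (by positivity), ENNReal.ofReal_sum_of_nonneg
      (fun _ _ => by positivity), Finset.sum_congr rfl fun k _ => hy k,
      ← lintegral_finsetSum']
    · exact (lintegral_mono fun t => ENNReal.sum_le_tsum F).trans hlt.le
    · intro k _
      exact ((measurable_enorm_sq φ).comp
        (measurePreserving_sub_right volume (intVec k)).measurable).aemeasurable
  calc ∑ k ∈ F, ‖(inner ℂ (translation (intVec k) φ) x : ℂ)‖ ^ 2
      ≤ ∑ k ∈ F, ‖y k‖ ^ 2 * ‖x‖ ^ 2 := by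
        refine Finset.sum_le_sum fun k _ => ?_
        rw [hin, ← mul_pow]
        gcongr
        exact norm_inner_le_norm _ _
    _ ≤ ε ^ 2 * ‖x‖ ^ 2 := by rw [← Finset.sum_mul]; gcongr
    _ = (ε * ‖x‖) ^ 2 := by ring

/-- The function `Dⁿ g` keeps its norm while its support is moved by `M⁻ⁿ` toward the origin, where
the analysis operator is small. -/
theorem tendsto_norm_analysis_dilation (hd : 0 < d) {M : Matrix (Fin d) (Fin d) ℝ} (hM : M.det ≠ 0)
    (hc : IsContracting M⁻¹) (f : L2 d) :
    Filter.Tendsto (fun n : ℕ => ‖analysis hφ ((dilation M ^ n) f)‖) Filter.atTop (nhds 0) := by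
  have main := tendsto_norm_analysis_of_dense hφ (fun n => dilation M ^ n) le_rfl zero_le_one ?_ f
  · simpa using main
  intro f ε hε
  obtain ⟨g, R, hR, hfg, hg⟩ := exists_bounded_support f hε
  refine ⟨g, hfg, ?_⟩
  rw [zero_mul, Metric.tendsto_atTop]
  intro η hη
  obtain ⟨δ, hδ, hsmall⟩ := exists_norm_analysis_le hφ hd (ε := η / (‖g‖ + 1)) (by positivity)
  obtain ⟨n₀, hn₀⟩ := Filter.eventually_atTop.mp (hc.eventually_lt R hδ)
  refine ⟨n₀, fun n hn => ?_⟩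
  obtain ⟨a, ha, haR, hab⟩ := hn₀ n hn
  have hMn : (M ^ n).det ≠ 0 := by rw [Matrix.det_pow]; exact pow_ne_zero _ hM
  have h1 := hsmall ((dilation M ^ n) g) (by
    rw [dilation_pow hM]
    exact dilation_support hMn ha (by rwa [← Matrix.inv_pow']) haR hg)
  rw [LinearIsometryEquiv.norm_map] at h1
  rw [Real.dist_eq, sub_zero, abs_of_nonneg (norm_nonneg _)]
  refine h1.trans_lt ?_
  rw [div_mul_eq_mul_div, div_lt_iff₀ (by positivity)]
  nlinarith [norm_nonneg g]

end LowResolution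

/-! ### Perfect reconstruction -/

/-- If the rows of a matrix are orthonormal in `ℓ²`, then it acts isometrically on `ℓ²`. -/
theorem hasSum_sq_of_orthonormal_rows {κ ι : Type*} {v : κ → lp (fun _ : ι => ℂ) 2}
    (hv : Orthonormal ℂ v) (a : lp (fun _ : κ => ℂ) 2) :
    ∃ x : lp (fun _ : ι => ℂ) 2, ‖x‖ = ‖a‖ ∧ ∀ i, HasSum (fun k => a k * v k i) (x i) := by
  refine ⟨hv.orthogonalFamily.linearIsometry a, LinearIsometry.norm_map _ _, fun i => ?_⟩
  have h1 := hv.orthogonalFamily.hasSum_linearIsometry a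
  exact h1.mapL (lp.evalCLM ℂ (fun _ : ι => ℂ) 2 i)

/-- The high-pass filter `(-1)^(q·n) conj(h_{l-n})`. -/
def highPass (l q : Fin d → ℤ) (h : (Fin d → ℤ) → ℂ) (n : Fin d → ℤ) : ℂ :=
  (-1 : ℂ) ^ (dotProduct q n) * (starRingEnd ℂ) (h (l - n))

/-- The rows of the polyphase matrix of a pair of filters. -/
def polyphase (A : Matrix (Fin d) (Fin d) ℤ) (h g : (Fin d → ℤ) → ℂ) (k : Fin d → ℤ) :
    (Fin d → ℤ) ⊕ (Fin d → ℤ) → ℂ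
  | .inl m => (starRingEnd ℂ) (h (k - A.mulVec m))
  | .inr m => (starRingEnd ℂ) (g (k - A.mulVec m))

theorem neg_one_zpow_eq (z : ℤ) : (-1 : ℂ) ^ z = if Even z then 1 else -1 := by
  split_ifs with h
  · exact h.neg_one_zpow
  · exact (Int.not_even_iff_odd.mp h).neg_one_zpow

section Reconstruction

variable {A : Matrix (Fin d) (Fin d) ℤ} {N : ℕ} {h : (Fin d → ℤ) → ℂ} {l q : Fin d → ℤ}

theorem finite_setOf_sub_mulVec_mem (hA : A.det.natAbs = 2) (s : Finset (Fin d → ℤ))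
    (k : Fin d → ℤ) : {m | k - A.mulVec m ∈ s}.Finite := by
  refine Set.Finite.preimage (f := fun m => k - A.mulVec m) ?_ s.finite_toSet
  intro x _ y _ hxy
  exact mulVec_injective hA (sub_right_injective hxy)

theorem finite_support_polyphase (hA : A.det.natAbs = 2) {g : (Fin d → ℤ) → ℂ}
    {s t : Finset (Fin d → ℤ)} (hs : ∀ n, n ∉ s → h n = 0) (ht : ∀ n, n ∉ t → g n = 0)
    (k : Fin d → ℤ) : (Function.support (polyphase A h g k)).Finite := by
  refine (((finite_setOf_sub_mulVec_mem hA s k).image Sum.inl).union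
    ((finite_setOf_sub_mulVec_mem hA t k).image Sum.inr)).subset ?_
  rintro (m | m) hm
  · refine Or.inl ⟨m, ?_, rfl⟩
    by_contra hn
    exact hm (by simp only [polyphase, hs _ hn, map_zero])
  · refine Or.inr ⟨m, ?_, rfl⟩
    by_contra hn
    exact hm (by simp only [polyphase, ht _ hn, map_zero])

theorem memlp_polyphase (hA : A.det.natAbs = 2) {g : (Fin d → ℤ) → ℂ}
    {s t : Finset (Fin d → ℤ)} (hs : ∀ n, n ∉ s → h n = 0) (ht : ∀ n, n ∉ t → g n = 0)
    (k : Fin d → ℤ) : Memℓp (polyphase A h g k) 2 := by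
  refine memℓp_gen (summable_of_hasFiniteSupport ((finite_support_polyphase hA hs ht k).subset ?_))
  intro i hi hi0
  apply hi
  simp [hi0]

/-- Summation over a coset of the lattice `A ℤ^d`. -/
theorem hasSum_coset (hA : A.det.natAbs = 2) (hq : ∀ x, x ∈ lattice A ↔ Even (dotProduct q x))
    {P : (Fin d → ℤ) → ℂ} {s : Finset (Fin d → ℤ)} (hs : ∀ n, n ∉ s → P n = 0) (c : Fin d → ℤ) :
    HasSum (fun m => P (c + A.mulVec m))
      (∑ n ∈ s, if (Even (dotProduct q n) ↔ Even (dotProduct q c)) then P n else 0) := by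
  have hinj : Function.Injective fun m => c + A.mulVec m :=
    (add_right_injective c).comp (mulVec_injective hA)
  have hpar : ∀ n, (Even (dotProduct q n) ↔ Even (dotProduct q c)) ↔
      n ∈ Set.range fun m => c + A.mulVec m := by
    intro n
    rw [← Int.even_sub, ← dotProduct_sub, ← hq, mem_lattice]
    exact exists_congr fun m => by rw [eq_sub_iff_add_eq']
  have h1 := hasSum_sum_of_ne_finset_zero (L := .unconditional _) (s := s)
    (f := fun n => if (Even (dotProduct q n) ↔ Even (dotProduct q c)) then P n else 0)
    (fun n hn => by simp [hs n hn])
  rw [← hinj.hasSum_iff fun n hn => if_neg fun h => hn ((hpar n).mp h)] at h1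
  refine h1.congr_fun fun m => ?_
  exact (if_pos ((hpar _).mpr ⟨m, rfl⟩)).symm

/-- The rows of the polyphase matrix are orthonormal. -/
theorem IsFiniteLawtonSolution.hasSum_polyphase (hh : IsFiniteLawtonSolution A N h)
    (hA : A.det.natAbs = 2) (hq : ∀ x, x ∈ lattice A ↔ Even (dotProduct q x))
    (hl : Odd (dotProduct q l)) (k k' : Fin d → ℤ) :
    HasSum (fun i => (inner ℂ (polyphase A h (highPass l q h) k i)
      (polyphase A h (highPass l q h) k' i) : ℂ)) (if k = k' then 1 else 0) := by
  set P : (Fin d → ℤ) → ℂ := fun n => h n * (starRingEnd ℂ) (h (n + (k' - k)))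
  have hP : ∀ n, n ∉ box d N → P n = 0 := fun n hn => by
    simp only [P, hh.finite n hn, zero_mul]
  set ε : (Fin d → ℤ) → ℂ := fun n => (-1 : ℂ) ^ (dotProduct q n)
  have hε : ∀ n m, ε (n - A.mulVec m) = ε n := by
    intro n m
    have := (hq _).mp ⟨m, rfl⟩
    simp only [ε, neg_one_zpow_eq, dotProduct_sub, Int.even_sub, this, iff_true]
  have hεc : ∀ n, (starRingEnd ℂ) (ε n) = ε n := by
    intro n
    simp only [ε, neg_one_zpow_eq]
    split_ifs <;> simp
  -- The low-pass columns give the sum of `P` over the coset of `k`, the high-pass columns `ε k * ε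
  -- k'` times its sum over the coset of `l - k'`.
  have h1 := (Equiv.neg (Fin d → ℤ)).hasSum_iff.mpr (hasSum_coset hA hq hP k)
  have h2 := (hasSum_coset hA hq hP (l - k')).mul_left (ε k * ε k')
  have h3 := HasSum.sum
    (f := fun i => (inner ℂ (polyphase A h (highPass l q h) k i)
      (polyphase A h (highPass l q h) k' i) : ℂ))
    (h1.congr_fun fun m => ?_) (h2.congr_fun fun m => ?_)
  · convert h3 using 1
    have hl' : ¬ Even (dotProduct q l) := Int.not_even_iff_odd.mpr hl
    rw [Finset.mul_sum, ← Finset.sum_add_distrib]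
    -- As `q·l` is odd, the two cosets are complementary when `k' - k` is even, and the signs agree:
    -- the full sum of `P` appears. When `k' - k` is odd they coincide and the signs are opposite:
    -- everything cancels.
    have h4 : ∀ n, (if (Even (dotProduct q n) ↔ Even (dotProduct q k)) then P n else 0) +
        ε k * ε k' * (if (Even (dotProduct q n) ↔ Even (dotProduct q (l - k'))) then P n else 0)
        = if Even (dotProduct q (k' - k)) then P n else 0 := by
      intro n
      simp only [ε, neg_one_zpow_eq, dotProduct_sub, Int.even_sub, hl', false_iff]
      by_cases e1 : Even (dotProduct q n) <;> by_cases e2 : Even (dotProduct q k) <;>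
        by_cases e3 : Even (dotProduct q k') <;> simp [e1, e2, e3]
    rw [Finset.sum_congr rfl fun n _ => h4 n]
    by_cases he : Even (dotProduct q (k' - k))
    · simp only [he, if_true]
      rw [hh.sum_mul_conj ((hq _).mpr he)]
      simp only [sub_eq_zero, eq_comm]
    · simp only [he, if_false, Finset.sum_const_zero]
      rw [if_neg]
      rintro rfl
      simp at he
  · simp only [Function.comp_apply, polyphase, RCLike.inner_apply, Complex.conj_conj, P,
      Equiv.neg_apply, Matrix.mulVec_neg]
    rw [mul_comm]
    congr 3
    abel
  · simp only [Function.comp_apply, polyphase, RCLike.inner_apply, Complex.conj_conj, P, highPass,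
      map_mul]
    change (starRingEnd ℂ) (ε (k' - A.mulVec m)) * _ * (ε (k - A.mulVec m) * _) = _
    rw [hε, hε, hεc, show l - (k' - A.mulVec m) = l - k' + A.mulVec m by abel,
      show l - (k - A.mulVec m) = l - k' + A.mulVec m + (k' - k) by abel]
    ring

variable {φ : L2 d}

/-- Translating by `m` shifts the filter by `A m`, so coarse coefficients are filtered and
subsampled fine ones: the action of the polyphase matrix. -/
theorem hasSum_inner_translation_sum (hA : A.det.natAbs = 2) (f : L2 d) {s : Finset (Fin d → ℤ)}
    {c : (Fin d → ℤ) → ℂ} (hc : ∀ n, n ∉ s → c n = 0) (m : Fin d → ℤ) :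
    HasSum (fun k => (inner ℂ (dilation (toReal A) (translation (intVec k) φ)) f : ℂ) *
      (starRingEnd ℂ) (c (k - A.mulVec m)))
      (inner ℂ (translation (intVec m)
        (∑ n ∈ s, c n • dilation (toReal A) (translation (intVec n) φ))) f) := by
  rw [translation_sum_dilation hA, sum_inner, ← (Equiv.addLeft (A.mulVec m)).hasSum_iff]
  have h1 := hasSum_sum_of_ne_finset_zero (L := .unconditional _) (s := s) (f := fun n => (inner ℂ
    (c n • dilation (toReal A) (translation (intVec (A.mulVec m + n)) φ)) f : ℂ))
    (fun n hn => by rw [hc n hn, zero_smul, inner_zero_left])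
  refine h1.congr_fun fun n => ?_
  simp only [Function.comp_apply, Equiv.coe_addLeft, add_sub_cancel_left, inner_smul_left]
  ring

theorem inner_dilation_left (f g : L2 d) (M : Matrix (Fin d) (Fin d) ℝ) :
    (inner ℂ (dilation M f) g : ℂ) = inner ℂ f ((dilation M)⁻¹ g) := by
  rw [← (dilation M).inner_map_map f]
  congr 1
  exact ((dilation M).apply_symm_apply g).symm

theorem highPass_eq_zero (hh : IsFiniteLawtonSolution A N h) (n : Fin d → ℤ)
    (hn : n ∉ (box d N).image fun m => l - m) : highPass l q h n = 0 := by
  rw [highPass, hh.finite, map_zero, mul_zero]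
  intro h1
  exact hn (Finset.mem_image.mpr ⟨l - n, h1, by abel⟩)

theorem IsFiniteLawtonSolution.wavelet_eq (hh : IsFiniteLawtonSolution A N h) (φ : L2 d) :
    wavelet A l q h φ = ∑ n ∈ (box d N).image (fun m => l - m),
      highPass l q h n • dilation (toReal A) (translation (intVec n) φ) := by
  refine finsum_eq_sum_of_support_subset _ fun n hn => ?_
  by_contra hnb
  refine hn ?_
  change highPass l q h n • _ = _
  rw [highPass_eq_zero hh n hnb, zero_smul]

/-- The energy of the wavelet coefficients at one level is the difference of the energies of the
scaling coefficients at consecutive levels. -/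
theorem IsFiniteLawtonSolution.hasSum_wavelet_level (hh : IsFiniteLawtonSolution A N h)
    (hA : A.det.natAbs = 2) (hq : ∀ x, x ∈ lattice A ↔ Even (dotProduct q x))
    (hl : Odd (dotProduct q l)) (hφ : IsBessel φ) (href : φ = refinement A N h φ) (f : L2 d) :
    HasSum (fun m => ‖(inner ℂ (translation (intVec m) (wavelet A l q h φ)) f : ℂ)‖ ^ 2)
      (‖analysis hφ ((dilation (toReal A))⁻¹ f)‖ ^ 2 - ‖analysis hφ f‖ ^ 2) := by
  let v : (Fin d → ℤ) → lp (fun _ : (Fin d → ℤ) ⊕ (Fin d → ℤ) => ℂ) 2 := fun k =>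
    ⟨polyphase A h (highPass l q h) k,
      memlp_polyphase hA hh.finite (highPass_eq_zero (l := l) (q := q) hh) k⟩
  have hv : Orthonormal ℂ v := by
    rw [orthonormal_iff_ite]
    intro k k'
    exact (lp.hasSum_inner (v k) (v k')).unique (hh.hasSum_polyphase hA hq hl k k')
  obtain ⟨x, hx, hsum⟩ := hasSum_sq_of_orthonormal_rows hv
    (analysis hφ ((dilation (toReal A))⁻¹ f))
  -- By the refinement equation, the isometry sends the fine scaling coefficients to the coarse
  -- scaling coefficients and, on the other summand, to the wavelet coefficients.
  have hxl : ∀ m, x (.inl m) = inner ℂ (translation (intVec m) φ) f := by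
    intro m
    have h1 := hasSum_inner_translation_sum (φ := φ) hA f hh.finite m
    rw [← refinement, ← href] at h1
    refine (hsum (.inl m)).unique (h1.congr_fun fun k => ?_)
    rw [inner_dilation_left]
    rfl
  have hxr : ∀ m, x (.inr m) = inner ℂ (translation (intVec m) (wavelet A l q h φ)) f := by
    intro m
    have h1 := hasSum_inner_translation_sum (φ := φ) hA f
      (highPass_eq_zero (l := l) (q := q) hh) m
    rw [← hh.wavelet_eq] at h1
    refine (hsum (.inr m)).unique (h1.congr_fun fun k => ?_)
    rw [inner_dilation_left]
    rfl
  have htot : HasSum (fun i => ‖x i‖ ^ 2) (‖analysis hφ ((dilation (toReal A))⁻¹ f)‖ ^ 2) := by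
    have := lp.hasSum_norm (p := 2) (by simp) x
    rw [hx] at this
    simpa using this
  have hL : HasSum ((fun i => ‖x i‖ ^ 2) ∘ Sum.inl) (‖analysis hφ f‖ ^ 2) :=
    (hasSum_sq_analysis hφ f).congr_fun fun m => by simp only [Function.comp_apply, hxl]
  have hR : Summable ((fun i => ‖x i‖ ^ 2) ∘ Sum.inr) :=
    htot.summable.comp_injective Sum.inr_injective
  have hval := htot.unique (hL.sum hR.hasSum)
  rw [hval, add_sub_cancel_left]
  exact hR.hasSum.congr_fun fun m => by simp only [Function.comp_apply, hxr]

end Reconstruction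

/-! ### The Parseval frame property -/

/-- Telescoping of a sequence indexed by `ℤ`. -/
theorem hasSum_int_telescope {e : ℤ → ℝ} (he : ∀ n, e n ≤ e (n + 1)) {a b : ℝ}
    (ha : Filter.Tendsto (fun n : ℕ => e n) Filter.atTop (nhds a))
    (hb : Filter.Tendsto (fun n : ℕ => e (-n)) Filter.atTop (nhds b)) :
    HasSum (fun n : ℤ => e (n + 1) - e n) (a - b) := by
  have h1 : HasSum (fun n : ℕ => e ((n : ℤ) + 1) - e n) (a - e 0) := by
    rw [hasSum_iff_tendsto_nat_of_nonneg fun n => sub_nonneg.mpr (he n)]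
    have h2 : ∀ n : ℕ, ∑ i ∈ Finset.range n, (e ((i : ℤ) + 1) - e i) = e n - e 0 := by
      intro n
      have := Finset.sum_range_sub (fun n : ℕ => e n) n
      push_cast at this
      exact this
    simp only [h2]
    exact ha.sub_const _
  have h3 : HasSum (fun n : ℕ => e (-((n : ℤ) + 1) + 1) - e (-((n : ℤ) + 1))) (e 0 - b) := by
    rw [hasSum_iff_tendsto_nat_of_nonneg fun n => sub_nonneg.mpr (he _)]
    have h2 : ∀ n : ℕ, ∑ i ∈ Finset.range n, (e (-((i : ℤ) + 1) + 1) - e (-((i : ℤ) + 1)))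
        = e 0 - e (-n) := by
      intro n
      have := Finset.sum_range_sub (fun n : ℕ => -e (-n)) n
      push_cast at this
      rw [neg_zero] at this
      rw [show e 0 - e (-n) = -e (-(n : ℤ)) - -e 0 by ring, ← this]
      refine Finset.sum_congr rfl fun i _ => ?_
      rw [show -((i : ℤ) + 1) + 1 = -(i : ℤ) by ring]
      ring
    simp only [h2]
    exact hb.const_sub _
  have h4 := HasSum.of_nat_of_neg_add_one (f := fun n : ℤ => e (n + 1) - e n) h1 h3
  rwa [show a - e 0 + (e 0 - b) = a - b by ring] at h4

/-- The energy of the scaling coefficients of `D⁻ⁿ f` grows from `0` at `n = -∞` to `‖f‖²` at `n =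
∞`, and the wavelet coefficients at level `n` carry the increment. -/
theorem IsBessel.isNormalizedTightFrame {φ ψ : L2 d} (hφ : IsBessel φ) (D : L2 d ≃ₗᵢ[ℂ] L2 d)
    (hlevel : ∀ f, HasSum (fun m => ‖(inner ℂ (translation (intVec m) ψ) f : ℂ)‖ ^ 2)
      (‖analysis hφ (D⁻¹ f)‖ ^ 2 - ‖analysis hφ f‖ ^ 2))
    (hhigh : ∀ f, Filter.Tendsto (fun n : ℕ => ‖analysis hφ ((D⁻¹ ^ n) f)‖) Filter.atTop
      (nhds ‖f‖))
    (hlow : ∀ f, Filter.Tendsto (fun n : ℕ => ‖analysis hφ ((D ^ n) f)‖) Filter.atTop (nhds 0)) :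
    IsNormalizedTightFrame fun p : ℤ × (Fin d → ℤ) => (D ^ p.1) (translation (intVec p.2) ψ) := by
  intro f
  let e : ℤ → ℝ := fun n => ‖analysis hφ ((D ^ n)⁻¹ f)‖ ^ 2
  have hrow : ∀ n : ℤ, HasSum (fun m : Fin d → ℤ =>
      ‖(inner ℂ f ((D ^ n) (translation (intVec m) ψ)) : ℂ)‖ ^ 2) (e (n + 1) - e n) := by
    intro n
    have h1 := hlevel ((D ^ n)⁻¹ f)
    have h2 : D⁻¹ ((D ^ n)⁻¹ f) = (D ^ (n + 1))⁻¹ f := by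
      rw [zpow_add_one, mul_inv_rev]
      rfl
    rw [h2] at h1
    refine h1.congr_fun fun m => ?_
    rw [norm_inner_symm, ← (D ^ n).inner_map_map _ ((D ^ n)⁻¹ f)]
    congr 3
    exact ((D ^ n).apply_symm_apply f).symm
  have hmono : ∀ n, e n ≤ e (n + 1) := fun n =>
    sub_nonneg.mp ((hrow n).nonneg fun m => by positivity)
  have hsum : HasSum (fun n : ℤ => e (n + 1) - e n) (‖f‖ ^ 2) := by
    have h1 := hasSum_int_telescope hmono (a := ‖f‖ ^ 2) (b := 0 ^ 2) ?_ ?_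
    · simpa using h1
    · refine ((hhigh f).pow 2).congr fun n => ?_
      simp only [e, zpow_natCast, inv_pow]
    · refine ((hlow f).pow 2).congr fun n => ?_
      simp only [e, zpow_neg, zpow_natCast, inv_inv]
  -- All terms are nonnegative, so summability of the row sums gives summability of the double
  -- family.
  have hs : Summable fun p : ℤ × (Fin d → ℤ) =>
      ‖(inner ℂ f ((D ^ p.1) (translation (intVec p.2) ψ)) : ℂ)‖ ^ 2 := by
    rw [summable_prod_of_nonneg fun p => by positivity]
    refine ⟨fun n => (hrow n).summable, ?_⟩
    simp only [(hrow _).tsum_eq]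
    exact hsum.summable
  have h1 := hs.hasSum
  rw [hs.tsum_prod] at h1
  simp only [(hrow _).tsum_eq, hsum.tsum_eq] at h1
  exact h1

/-! ### The spaces `V^{(n)}` -/

theorem mem_space {B : Matrix (Fin d) (Fin d) ℤ} {φ : L2 d} {n : ℤ} {x : L2 d} :
    x ∈ space B φ n ↔ ∃ y ∈ spaceZero φ, (dilation (toReal B) ^ n) y = x := Iff.rfl

theorem translation_mem_spaceZero (φ : L2 d) (k : Fin d → ℤ) :
    translation (intVec k) φ ∈ spaceZero φ :=
  Submodule.le_topologicalClosure _ (Submodule.subset_span ⟨k, rfl⟩)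

theorem isClosed_space (B : Matrix (Fin d) (Fin d) ℤ) (φ : L2 d) (n : ℤ) :
    IsClosed (space B φ n : Set (L2 d)) := by
  have h : (space B φ n : Set (L2 d))
      = (dilation (toReal B) ^ n).toHomeomorph '' (spaceZero φ : Set (L2 d)) := rfl
  rw [h]
  exact (dilation (toReal B) ^ n).toHomeomorph.isClosedMap _
    (Submodule.isClosed_topologicalClosure _)

section Spaces

variable {B : Matrix (Fin d) (Fin d) ℤ} {φ : L2 d} {ι : Type*} {s : Finset ι} {c : ι → ℂ}
  {k : ι → Fin d → ℤ}

/-- Stated for an arbitrary finite combination with integral shifts, so that it serves the scaling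
function and the wavelet. -/
theorem translation_mem_space_one (hB : B.det.natAbs = 2) {x : L2 d}
    (hx : x = ∑ i ∈ s, c i • dilation (toReal B) (translation (intVec (k i)) φ))
    (m : Fin d → ℤ) : translation (intVec m) x ∈ space B φ 1 := by
  rw [hx, map_sum]
  refine Submodule.sum_mem _ fun i _ => ?_
  rw [map_smul, translation_intVec_dilation hB, translation_add, ← intVec_add]
  refine Submodule.smul_mem _ _ (mem_space.mpr
    ⟨_, translation_mem_spaceZero φ (B.mulVec m + k i), ?_⟩)
  rw [zpow_one]

theorem zpow_apply_mem_space {x : L2 d} (hx : x ∈ space B φ 1) (n : ℤ) :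
    (dilation (toReal B) ^ n) x ∈ space B φ (n + 1) := by
  obtain ⟨y, hy, rfl⟩ := mem_space.mp hx
  exact mem_space.mpr ⟨y, hy, by rw [zpow_add]; rfl⟩

theorem space_mono (hB : B.det.natAbs = 2)
    (hφ : φ = ∑ i ∈ s, c i • dilation (toReal B) (translation (intVec (k i)) φ)) (n : ℤ) :
    space B φ n ≤ space B φ (n + 1) := by
  have h1 : spaceZero φ ≤ space B φ 1 := by
    refine Submodule.topologicalClosure_minimal _ (Submodule.span_le.mpr ?_) (isClosed_space B φ 1)
    rintro _ ⟨m, rfl⟩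
    exact translation_mem_space_one hB hφ m
  rintro x hx
  obtain ⟨y, hy, rfl⟩ := mem_space.mp hx
  exact zpow_apply_mem_space (h1 hy) n

/-- Every frame vector lies in some `V^(n)`, so a vector orthogonal to all these spaces has only
zero frame coefficients and, by the Parseval identity, norm zero. -/
theorem closure_iUnion_space (hmono : ∀ n : ℤ, space B φ n ≤ space B φ (n + 1)) {ψ : L2 d}
    (hψ : ∀ m : Fin d → ℤ, translation (intVec m) ψ ∈ space B φ 1)
    (hframe : IsParsevalFrameWavelet B ψ) :
    closure (⋃ n : ℤ, (space B φ n : Set (L2 d))) = Set.univ := by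
  have hdir : Directed (· ≤ ·) (space B φ) := (monotone_int_of_le_succ hmono).directed_le
  have hcoe := Submodule.coe_iSup_of_directed _ hdir
  rw [← hcoe, ← Submodule.topologicalClosure_coe]
  suffices h : (⨆ n, space B φ n).topologicalClosure = ⊤ by rw [h]; rfl
  rw [Submodule.topologicalClosure_eq_top_iff, Submodule.eq_bot_iff]
  intro f hf
  have h1 := hframe f
  have h2 : ∀ p : ℤ × (Fin d → ℤ),
      ‖(inner ℂ f ((dilation (toReal B) ^ p.1) (translation (intVec p.2) ψ)) : ℂ)‖ ^ 2 = 0 := by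
    intro p
    rw [(Submodule.mem_orthogonal' _ f).mp hf _
      (Submodule.mem_iSup_of_mem (p.1 + 1) (zpow_apply_mem_space (hψ p.2) p.1))]
    simp
  simp only [h2] at h1
  have h3 := h1.unique hasSum_zero
  exact norm_eq_zero.mp (pow_eq_zero_iff two_ne_zero |>.mp h3)

end Spaces

/-! ### Change of lattice basis -/

section Pullback

variable {A₀ A S : Matrix (Fin d) (Fin d) ℤ} {l q : Fin d → ℤ}

theorem PartitionData.det_toReal_S_ne_zero (hP : PartitionData A₀ A S l q) :
    (toReal S).det ≠ 0 := by
  rw [det_toReal]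
  exact_mod_cast hP.isUnit_det_S.ne_zero

theorem PartitionData.S_mul (hP : PartitionData A₀ A S l q) : S * A₀ = A * S := by
  rw [hP.similar, ← mul_assoc, ← mul_assoc, Matrix.mul_nonsing_inv _ hP.isUnit_det_S, one_mul]

/-- The relation `S A₀ = A S`, read through the order reversal `U_M U_N = U_(N M)`. -/
theorem PartitionData.dilation_comm (hP : PartitionData A₀ A S l q) (hA : A.det.natAbs = 2)
    (x : L2 d) : dilation (toReal S) (dilation (toReal A) x)
      = dilation (toReal A₀) (dilation (toReal S) x) := by
  rw [dilation_dilation hP.det_toReal_S_ne_zero (det_toReal_ne_zero hA), dilation_dilation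
    (det_toReal_ne_zero (hP.det_eq ▸ hA)) hP.det_toReal_S_ne_zero, ← toReal_mul, ← toReal_mul,
    hP.S_mul]

theorem PartitionData.translation_dilation_S (hP : PartitionData A₀ A S l q) (m : Fin d → ℤ)
    (x : L2 d) : translation (intVec m) (dilation (toReal S) x)
      = dilation (toReal S) (translation (intVec (S.mulVec m)) x) := by
  rw [translation_dilation hP.det_toReal_S_ne_zero, act_intVec]

theorem PartitionData.pullback (hP : PartitionData A₀ A S l q) (hA : A.det.natAbs = 2)
    (n : Fin d → ℤ) (x : L2 d) :
    dilation (toReal S) (dilation (toReal A) (translation (intVec n) x))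
      = dilation (toReal A₀) (translation (intVec (S⁻¹.mulVec n)) (dilation (toReal S) x)) := by
  rw [hP.dilation_comm hA, hP.translation_dilation_S, Matrix.mulVec_mulVec,
    Matrix.mul_nonsing_inv _ hP.isUnit_det_S, Matrix.one_mulVec]

theorem PartitionData.zpow_dilation (hP : PartitionData A₀ A S l q) (hA : A.det.natAbs = 2)
    (n : ℤ) (x : L2 d) : (dilation (toReal A₀) ^ n) (dilation (toReal S) x)
      = dilation (toReal S) ((dilation (toReal A) ^ n) x) := by
  have h1 : dilation (toReal A₀)
      = dilation (toReal S) * dilation (toReal A) * (dilation (toReal S))⁻¹ := by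
    rw [eq_mul_inv_iff_mul_eq]
    exact LinearIsometryEquiv.ext fun y => (hP.dilation_comm hA y).symm
  have h2 : dilation (toReal A₀) ^ n * dilation (toReal S)
      = dilation (toReal S) * dilation (toReal A) ^ n := by
    rw [h1, conj_zpow, inv_mul_cancel_right]
  exact congrArg (fun T : L2 d ≃ₗᵢ[ℂ] L2 d => T x) h2

/-- The Parseval frame property is transported by a change of lattice basis. -/
theorem PartitionData.isParsevalFrameWavelet (hP : PartitionData A₀ A S l q)
    (hA : A.det.natAbs = 2) {ψ : L2 d} (hψ : IsParsevalFrameWavelet A ψ) :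
    IsParsevalFrameWavelet A₀ (dilation (toReal S) ψ) := by
  intro f
  -- Conjugation by `U_S` permutes the integer translations, because `S` is invertible over `ℤ`.
  let σ : (Fin d → ℤ) ≃ (Fin d → ℤ) :=
    ⟨S.mulVec, S⁻¹.mulVec,
      fun m => by simp [Matrix.nonsing_inv_mul _ hP.isUnit_det_S],
      fun m => by simp [Matrix.mul_nonsing_inv _ hP.isUnit_det_S]⟩
  have h1 := hψ ((dilation (toReal S))⁻¹ f)
  rw [← ((Equiv.refl ℤ).prodCongr σ).hasSum_iff, LinearIsometryEquiv.norm_map] at h1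
  refine h1.congr_fun fun p => ?_
  simp only [Function.comp_apply, Equiv.prodCongr_apply, Prod.map, Equiv.refl_apply]
  rw [hP.translation_dilation_S, hP.zpow_dilation hA, ← (dilation (toReal S)).inner_map_map
    ((dilation (toReal S))⁻¹ f)]
  congr 3
  exact ((dilation (toReal S)).apply_symm_apply f).symm

end Pullback

theorem PartitionData.refine_pullback_eq {A₀ A S : Matrix (Fin d) (Fin d) ℤ}
    {l q : Fin d → ℤ} {N : ℕ} {h : (Fin d → ℤ) → ℂ} (hP : PartitionData A₀ A S l q)
    (hA : A.det.natAbs = 2) {φ : L2 d} (hφ : φ = refinement A N h φ) :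
    dilation (toReal S) φ = ∑ n ∈ box d N, h n • dilation (toReal A₀)
      (translation (intVec (S⁻¹.mulVec n)) (dilation (toReal S) φ)) := by
  have h1 := congrArg (dilation (toReal S)) hφ
  simp only [refinement, map_sum, map_smul, hP.pullback hA] at h1
  exact h1

theorem IsFiniteLawtonSolution.wavelet_pullback_eq {A₀ A S : Matrix (Fin d) (Fin d) ℤ}
    {l q : Fin d → ℤ} {N : ℕ} {h : (Fin d → ℤ) → ℂ} (hh : IsFiniteLawtonSolution A N h)
    (hP : PartitionData A₀ A S l q) (hA : A.det.natAbs = 2) (φ : L2 d) :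
    dilation (toReal S) (wavelet A l q h φ) = ∑ n ∈ (box d N).image (fun m => l - m),
      ((-1 : ℂ) ^ (dotProduct q n) * (starRingEnd ℂ) (h (l - n))) • dilation (toReal A₀)
        (translation (intVec (S⁻¹.mulVec n)) (dilation (toReal S) φ)) := by
  rw [hh.wavelet_eq]
  simp only [map_sum, map_smul, hP.pullback hA, highPass]


/-- The scaling function and the wavelet of a finite solution of Lawton's equations. -/
theorem IsFiniteLawtonSolution.isParsevalFrameWavelet {A : Matrix (Fin d) (Fin d) ℤ}
    {N : ℕ} {h : (Fin d → ℤ) → ℂ} {l q : Fin d → ℤ} (hh : IsFiniteLawtonSolution A N h)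
    (hd : 0 < d) (hA : A.det.natAbs = 2) (hexp : IsExpansive A)
    (hq : ∀ x, x ∈ lattice A ↔ Even (dotProduct q x)) (hl : Odd (dotProduct q l))
    {φ : L2 d} (hφ : IsScaling A N h φ) : IsParsevalFrameWavelet A (wavelet A l q h φ) := by
  have hA0 : A.det ≠ 0 := by rintro h0; simp [h0] at hA
  have hAr := det_toReal_ne_zero hA
  obtain ⟨K, hK, hm⟩ := hh.exists_mask_bound
  have hB : IsBessel φ := hφ.bessel
  exact hB.isNormalizedTightFrame _ (hh.hasSum_wavelet_level hA hq hl hB hφ.refine_eq)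
    (tendsto_norm_analysis_dilation_inv hB hφ.coeFn_FT
      (tendsto_maskProd_zero (hexp.isContracting_transpose_inv hA0) hK hm) hAr
      (hexp.isContracting_transpose_inv hA0))
    (tendsto_norm_analysis_dilation hB hd hAr (hexp.isContracting_inv hA0))

end

end ParsevalWavelet

/-! ### Assembly of the theorem -/

theorem theorem9p1 {d : ℕ} (A₀ : Matrix (Fin d) (Fin d) ℤ)
    (hexp : ParsevalWavelet.IsExpansive A₀) (hdet : A₀.det = 2 ∨ A₀.det = -2) :
    (∃ (A S : Matrix (Fin d) (Fin d) ℤ) (l q : Fin d → ℤ),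
      ParsevalWavelet.PartitionData A₀ A S l q) ∧
    ∀ (A S : Matrix (Fin d) (Fin d) ℤ) (l q : Fin d → ℤ),
      ParsevalWavelet.PartitionData A₀ A S l q →
    ∀ (N₀ : ℕ) (h : (Fin d → ℤ) → ℂ), ParsevalWavelet.IsFiniteLawtonSolution A N₀ h →
      (∀ ξ : ParsevalWavelet.Euc d, Multipliable (ParsevalWavelet.factor A h ξ)) ∧
      ∃ hg : MeasureTheory.MemLp (ParsevalWavelet.scalingFourier A h) 2
          (MeasureTheory.volume : MeasureTheory.Measure (ParsevalWavelet.Euc d)),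
        ParsevalWavelet.IsParsevalFrameWavelet A₀
          (ParsevalWavelet.waveletPullback A S l q h hg) ∧
        ParsevalWavelet.scalingPullback A S h hg =
          ∑ n ∈ ParsevalWavelet.box d N₀,
            h n • ParsevalWavelet.dilation (ParsevalWavelet.toReal A₀)
              (ParsevalWavelet.translation (ParsevalWavelet.intVec (S⁻¹.mulVec n))
                (ParsevalWavelet.scalingPullback A S h hg)) ∧
        ParsevalWavelet.waveletPullback A S l q h hg =
          ∑ n ∈ (ParsevalWavelet.box d N₀).image (fun m => l - m),
            ((-1 : ℂ) ^ (dotProduct q n) * (starRingEnd ℂ) (h (l - n))) •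
              ParsevalWavelet.dilation (ParsevalWavelet.toReal A₀)
                (ParsevalWavelet.translation (ParsevalWavelet.intVec (S⁻¹.mulVec n))
                  (ParsevalWavelet.scalingPullback A S h hg)) ∧
        (∀ n : ℤ, ParsevalWavelet.space A₀ (ParsevalWavelet.scalingPullback A S h hg) n ≤
          ParsevalWavelet.space A₀ (ParsevalWavelet.scalingPullback A S h hg) (n + 1)) ∧
        closure (⋃ n : ℤ, (ParsevalWavelet.space A₀
            (ParsevalWavelet.scalingPullback A S h hg) n : Set (ParsevalWavelet.L2 d)))
          = Set.univ := by
  have hA₀ : A₀.det.natAbs = 2 := by omega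
  refine ⟨ParsevalWavelet.exists_partitionData A₀ hA₀, fun A S l q hP N h hh => ?_⟩
  have hA : A.det.natAbs = 2 := hP.det_eq ▸ hA₀
  have hA0 : A.det ≠ 0 := fun h0 => by simp [h0] at hA
  -- In dimension zero the empty determinant is `1`, not `±2`.
  have hd : 0 < d := by
    rcases Nat.eq_zero_or_pos d with rfl | hd
    · simp at hA
    · exact hd
  have hexpA := hP.isExpansive hexp
  have hc := hexpA.isContracting_transpose_inv hA0
  have hg := hh.memLp_scalingFourier hA hc
  have hφ := hh.isScaling hA hc (hh.coeFn_FT_scaling hA hc hg)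
  have hframe := hP.isParsevalFrameWavelet hA
    (hh.isParsevalFrameWavelet hd hA hexpA hP.parity hP.odd_shift hφ)
  have hscaling := hP.refine_pullback_eq hA hφ.refine_eq
  have hwavelet := hh.wavelet_pullback_eq hP hA (ParsevalWavelet.scaling A h hg)
  have hmono := ParsevalWavelet.space_mono hA₀ hscaling
  exact ⟨hh.multipliable_factor hc, hg, hframe, hscaling, hwavelet, hmono,
    ParsevalWavelet.closure_iUnion_space hmono
      (ParsevalWavelet.translation_mem_space_one hA₀ hwavelet) hframe⟩
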